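/- Let $G=(V,E)$ be a simple connected (unweighted, locally finite, possibly infinite) graph with at least two vertices, and suppose that its maximal vertex degree $D$ is finite. Let $\Delta f(x)=\sum_{y\sim x}(f(y)-f(x))$ be the non-normalized Laplacian, and let $\lambda_0\le\lambda_1\le\lambda_2\le\dots$ be the eigenvalues of $-\Delta$ in increasing order, repeated according to multiplicity (so $0=\lambda_0<\lambda_1$ if $V$ is finite). (If $V$ is infinite, eigenvalues are those of $-\Delta$ on $\ell^2(V)$, and $\lambda_k=\lambda$ means that, counted with multiplicity, at most $k$ eigenvalues are $<\lambda$ and at least $k+1$ are $\le\lambda$.) For $f,g:V\to\mathbb R$ put $$2\Gamma(f,g)=\Delta(fg)-f\Delta g-g\Delta f,\qquad 2\Gamma_2(f,g)=\Delta\Gamma(f,g)-\Gamma(f,\Delta g)-\Gamma(g,\Delta f),$$ and say that $G$ satisfies $CD(K,\infty)$ if $\Gamma_2(f,f)(x)\ge K\,\Gamma(f,f)(x)$ for all $f:V\to\mathbb R$ and all $x\in V$. Let $\operatorname{diam}_d(G)=\sup_{x,y}d(x,y)\in[0,\infty]$ be the diameter for the combinatorial graph distance $d$. The $D$-dimensional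 hypercube is the graph whose vertices are the subsets of $\{1,\dots,D\}$, with $A\sim B$ if and only if the symmetric difference of $A$ and $B$ has exactly one element. Then the following are equivalent: 1. $G$ is (isomorphic to) the $D$-dimensional hypercube. 2. There is $K>0$ such that $G$ satisfies $CD(K,\infty)$ and $\lambda_D=K$. 3. There is $K>0$ such that $G$ satisfies $CD(K,\infty)$ and $\operatorname{diam}_d(G)=\frac{2D}{K}$. -/

import Mathlib

open scoped ENNReal

noncomputable section

namespace GraphCurvature

variable {V : Type*} (G : SimpleGraph V) [G.LocallyFinite]

/-- The non-normalized graph Laplacian `Δ f (x) = ∑_{y ∼ x} (f y - f x)`. -/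
def laplacian (f : V → ℝ) : V → ℝ :=
  fun x => ∑ y ∈ G.neighborFinset x, (f y - f x)

/-- The Bakry–Émery operator `Γ`, with `2 Γ(f,g) = Δ(fg) - f Δg - g Δf`. -/
def Gam (f g : V → ℝ) : V → ℝ :=
  fun x => (laplacian G (f * g) x - f x * laplacian G g x - g x * laplacian G f x) / 2

/-- The iterated operator `Γ₂`, with `2 Γ₂(f,g) = Δ Γ(f,g) - Γ(f,Δg) - Γ(g,Δf)`. -/
def Gam2 (f g : V → ℝ) : V → ℝ :=
  fun x => (laplacian G (Gam G f g) x
    - Gam G f (laplacian G g) x - Gam G g (laplacian G f) x) / 2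

/-- The curvature-dimension inequality `CD(K,n)` at a vertex, for `n ∈ (0,∞]`; for `n = ∞` the
factor `(n⁻¹).toReal` is `0`. -/
def CDAt (K : ℝ) (n : ℝ≥0∞) (x : V) : Prop :=
  ∀ f : V → ℝ, (n⁻¹).toReal * (laplacian G f x) ^ 2 + K * Gam G f f x ≤ Gam2 G f f x

/-- The (global) curvature-dimension inequality `CD(K,n)`. -/
def CD (K : ℝ) (n : ℝ≥0∞) : Prop :=
  ∀ x : V, CDAt G K n x

/-- The eigenspace of `-Δ` on `ℓ²(V)` for `μ`: square-summable `f` with `-Δ f = μ f`.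
If `V` is finite, every function is square-summable. -/
def eigenspace (μ : ℝ) : Submodule ℝ (V → ℝ) where
  carrier := {f | Memℓp f 2 ∧ ∀ x, -laplacian G f x = μ * f x}
  zero_mem' := ⟨zero_memℓp, fun x => by simp [laplacian]⟩
  add_mem' := by
    rintro f g ⟨hf, hf'⟩ ⟨hg, hg'⟩
    refine ⟨hf.add hg, fun x => ?_⟩
    have h : laplacian G (f + g) x = laplacian G f x + laplacian G g x := by
      simp only [laplacian, Pi.add_apply, ← Finset.sum_add_distrib]
      exact Finset.sum_congr rfl fun y _ => by ring
    rw [h, Pi.add_apply, mul_add, ← hf' x, ← hg' x]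
    ring
  smul_mem' := by
    rintro c f ⟨hf, hf'⟩
    refine ⟨hf.const_smul c, fun x => ?_⟩
    have h : laplacian G (c • f) x = c * laplacian G f x := by
      simp only [laplacian, Pi.smul_apply, smul_eq_mul, Finset.mul_sum]
      exact Finset.sum_congr rfl fun y _ => by ring
    rw [h, Pi.smul_apply, smul_eq_mul, mul_left_comm, ← hf' x]
    ring

/-- `lam = λ_k`, where `λ_0 ≤ λ_1 ≤ …` are the eigenvalues of `-Δ` in increasing order and
repeated according to multiplicity: at most `k` eigenvalues (with multiplicity) are smaller than
`lam`, and at least `k + 1` are smaller than or equal to `lam`. (Eigenspaces for distinct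
eigenvalues are independent, so the rank of their span is the sum of the multiplicities.) -/
def IsOrderedEigenvalue (k : ℕ) (lam : ℝ) : Prop :=
  Module.rank ℝ ↥(⨆ μ : Set.Iio lam, eigenspace G μ) ≤ k ∧
    k < Module.rank ℝ ↥(⨆ μ : Set.Iic lam, eigenspace G μ)

/-- The `D`-dimensional hypercube: the vertices are the subsets of a `D`-element set, and two are
adjacent iff their symmetric difference has exactly one element. -/
def hypercube (D : ℕ) : SimpleGraph (Finset (Fin D)) where
  Adj A B := (symmDiff A B).card = 1
  symm := ⟨fun A B h => by rwa [symmDiff_comm]⟩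
  loopless := ⟨fun A h => by simp at h⟩

/-- `G` is a `D`-dimensional hypercube. -/
def IsHypercube {V : Type*} (G : SimpleGraph V) (D : ℕ) : Prop :=
  Nonempty (G ≃g hypercube D)

end GraphCurvature

end

namespace GraphCurvature

/-! Everything rests on the equality case of the Bochner argument. Under CD(K,∞), summing `Γ₂ ≥ KΓ`
over an ℓ² eigenfunction shows that eigenfunctions below `K` are constant. For those at `K` itself,
`Γ(f,f)` is constant and `f` is a null vector of `Γ₂ - KΓ` at every vertex
(`Gam_eq_of_mem_eigenspace`). Testing a null vector against a Dirac mass at distance two gives a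
linear relation over common neighbours (`sum_common_neighbors_eq_zero`).

Eigenvalue rigidity: `λ_D = K` gives the eigenspace of `K` dimension at least `D`. The gradient at a
vertex is injective on it, so some eigenfunction has its gradient at that vertex supported on any
prescribed single edge. Such functions take the values ±1/2 and each changes along exactly one edge
at every vertex. They are the coordinates of a cube (`isHypercube_of_le_rank`).

Diameter rigidity: finite diameter makes the graph finite. The heat flow, rescaled by `exp(Kt)`,
turns the distance from an endpoint `x₀` of a diameter into an eigenfunction for `K` with the same
gradient bound and oscillation (`exists_mem_eigenspace_of_sub_ge`). Equality in Cauchy–Schwarz makes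
it `dist x₀` up to a constant, forces `K = 2` and fixes the combinatorics of the spheres
(`IsCubicShell`). For each neighbour `x` of `x₀`, the vertices with a geodesic from `x₀` through `x`
then form a half-cube matched with its complement, whose signed indicator is an eigenfunction for 2.
These are `D` independent functions, so eigenvalue rigidity applies.

For the cube itself, `4Γ₂` is the sum of the squares of the mixed second differences, which gives
CD(2,∞). -/

/-- A property preserved under adjacency spreads over a connected graph. -/
theorem forall_of_adj {V : Type*} {G : SimpleGraph V} (hG : G.Connected) {P : V → Prop} {x : V}
    (hx : P x)
    (hP : ∀ y z, G.Adj y z → P y → P z) (y : V) : P y := by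
  obtain ⟨p⟩ := hG.preconnected x y
  induction p with
  | nil => exact hx
  | cons h _ ih => exact ih (hP _ _ h hx)

/-! ### Calculus of `Γ` and `Γ₂`, and null vectors of `Γ₂ - KΓ` -/

section Basic

variable {V : Type*} (G : SimpleGraph V) [G.LocallyFinite]

theorem Gam_eq (f g : V → ℝ) (x : V) :
    Gam G f g x = (∑ y ∈ G.neighborFinset x, (f y - f x) * (g y - g x)) / 2 := by
  simp only [Gam, laplacian, Pi.mul_apply, Finset.mul_sum, ← Finset.sum_sub_distrib]
  congr 1
  exact Finset.sum_congr rfl fun y _ => by ring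

theorem two_mul_Gam_self (f : V → ℝ) (x : V) :
    2 * Gam G f f x = ∑ y ∈ G.neighborFinset x, (f y - f x) ^ 2 := by
  rw [Gam_eq, mul_div_cancel₀ _ two_ne_zero]
  exact Finset.sum_congr rfl fun y _ => by ring

theorem Gam_self_nonneg (f : V → ℝ) (x : V) : 0 ≤ Gam G f f x := by
  have h := two_mul_Gam_self G f x
  have : 0 ≤ ∑ y ∈ G.neighborFinset x, (f y - f x) ^ 2 := Finset.sum_nonneg fun y _ => sq_nonneg _
  linarith

theorem eq_of_Gam_self_eq_zero {f : V → ℝ} {x y : V} (h : Gam G f f x = 0) (hxy : G.Adj x y) :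
    f y = f x := by
  have h2 := two_mul_Gam_self G f x
  rw [h, mul_zero, eq_comm, Finset.sum_eq_zero_iff_of_nonneg fun y _ => sq_nonneg _] at h2
  have := h2 y (by simpa using hxy)
  exact sub_eq_zero.1 (pow_eq_zero_iff two_ne_zero |>.1 this)

theorem laplacian_smul (c : ℝ) (f : V → ℝ) : laplacian G (c • f) = c • laplacian G f := by
  funext x
  simp only [laplacian, Pi.smul_apply, smul_eq_mul, Finset.mul_sum, mul_sub]

theorem laplacian_add (f g : V → ℝ) : laplacian G (f + g) = laplacian G f + laplacian G g := by
  funext x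
  simp only [laplacian, Pi.add_apply, ← Finset.sum_add_distrib]
  exact Finset.sum_congr rfl fun y _ => by ring

theorem Gam_comm (f g : V → ℝ) : Gam G f g = Gam G g f := by
  funext x
  simp only [Gam_eq, mul_comm]

theorem Gam_smul_right (c : ℝ) (f g : V → ℝ) : Gam G f (c • g) = c • Gam G f g := by
  funext x
  simp only [Gam_eq, Pi.smul_apply, smul_eq_mul, ← mul_div_assoc, Finset.mul_sum]
  congr 1
  exact Finset.sum_congr rfl fun y _ => by ring

theorem Gam_add_right (f g h : V → ℝ) : Gam G f (g + h) = Gam G f g + Gam G f h := by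
  funext x
  simp only [Gam_eq, Pi.add_apply, ← add_div, ← Finset.sum_add_distrib]
  congr 1
  exact Finset.sum_congr rfl fun y _ => by ring

theorem Gam_smul_left (c : ℝ) (f g : V → ℝ) : Gam G (c • f) g = c • Gam G f g := by
  rw [Gam_comm, Gam_smul_right, Gam_comm]

theorem Gam_add_left (f g h : V → ℝ) : Gam G (f + g) h = Gam G f h + Gam G g h := by
  rw [Gam_comm, Gam_add_right, Gam_comm, Gam_comm G g]

theorem Gam2_comm (f g : V → ℝ) : Gam2 G f g = Gam2 G g f := by
  funext x
  simp only [Gam2, Gam_comm G g f]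
  ring

theorem Gam2_add_right (f g h : V → ℝ) : Gam2 G f (g + h) = Gam2 G f g + Gam2 G f h := by
  funext x
  simp only [Gam2, Gam_add_right, Gam_add_left, laplacian_add, Pi.add_apply]
  ring

theorem Gam2_smul_right (c : ℝ) (f g : V → ℝ) : Gam2 G f (c • g) = c • Gam2 G f g := by
  funext x
  simp only [Gam2, Gam_smul_right, Gam_smul_left, laplacian_smul, Pi.smul_apply, smul_eq_mul]
  ring

theorem Gam2_add_left (f g h : V → ℝ) : Gam2 G (f + g) h = Gam2 G f h + Gam2 G g h := by
  rw [Gam2_comm, Gam2_add_right, Gam2_comm, Gam2_comm G g]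

theorem Gam2_smul_left (c : ℝ) (f g : V → ℝ) : Gam2 G (c • f) g = c • Gam2 G f g := by
  rw [Gam2_comm, Gam2_smul_right, Gam2_comm]

/-- An expression of `Γ₂` as a sum of second differences and lower-order terms. -/
theorem four_mul_Gam2 (f g : V → ℝ) (x : V) :
    4 * Gam2 G f g x =
      ∑ y ∈ G.neighborFinset x, ∑ z ∈ G.neighborFinset y,
          (f z - 2 * f y + f x) * (g z - 2 * g y + g x)
        - ∑ y ∈ G.neighborFinset x, (G.degree x + G.degree y : ℝ) * ((f y - f x) * (g y - g x))
        + 2 * (laplacian G f x * laplacian G g x) := by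
  have h1 : 2 * laplacian G (Gam G f g) x =
      ∑ y ∈ G.neighborFinset x, ∑ z ∈ G.neighborFinset y, (f z - f y) * (g z - g y)
        - G.degree x * ∑ y ∈ G.neighborFinset x, (f y - f x) * (g y - g x) := by
    rw [laplacian, Finset.sum_sub_distrib, Finset.sum_const,
      SimpleGraph.card_neighborFinset_eq_degree, nsmul_eq_mul, mul_sub, Finset.mul_sum]
    simp only [Gam_eq, mul_div_cancel₀ _ (two_ne_zero' ℝ)]
    ring
  have h2 : ∀ f g : V → ℝ, 2 * Gam G f (laplacian G g) x =
      ∑ y ∈ G.neighborFinset x, ∑ z ∈ G.neighborFinset y, (f y - f x) * (g z - g y)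
        - laplacian G f x * laplacian G g x := by
    intro f g
    rw [Gam_eq, mul_div_cancel₀ _ two_ne_zero, laplacian, laplacian, Finset.sum_mul,
      ← Finset.sum_sub_distrib]
    refine Finset.sum_congr rfl fun y _ => ?_
    rw [← Finset.mul_sum, mul_sub]
    rfl
  have h3 : ∑ y ∈ G.neighborFinset x, ∑ z ∈ G.neighborFinset y,
        (f z - 2 * f y + f x) * (g z - 2 * g y + g x) =
      ∑ y ∈ G.neighborFinset x, ∑ z ∈ G.neighborFinset y, (f z - f y) * (g z - g y)
      - ∑ y ∈ G.neighborFinset x, ∑ z ∈ G.neighborFinset y, (f y - f x) * (g z - g y)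
      - ∑ y ∈ G.neighborFinset x, ∑ z ∈ G.neighborFinset y, (g y - g x) * (f z - f y)
      + ∑ y ∈ G.neighborFinset x, (G.degree y : ℝ) * ((f y - f x) * (g y - g x)) := by
    rw [← Finset.sum_sub_distrib, ← Finset.sum_sub_distrib, ← Finset.sum_add_distrib]
    refine Finset.sum_congr rfl fun y _ => ?_
    rw [← SimpleGraph.card_neighborFinset_eq_degree, ← nsmul_eq_mul, ← Finset.sum_const,
      ← Finset.sum_sub_distrib, ← Finset.sum_sub_distrib, ← Finset.sum_add_distrib]
    exact Finset.sum_congr rfl fun z _ => by ring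
  have h4 : ∑ y ∈ G.neighborFinset x, (G.degree x + G.degree y : ℝ) *
        ((f y - f x) * (g y - g x)) =
      G.degree x * ∑ y ∈ G.neighborFinset x, (f y - f x) * (g y - g x) +
      ∑ y ∈ G.neighborFinset x, (G.degree y : ℝ) * ((f y - f x) * (g y - g x)) := by
    rw [Finset.mul_sum, ← Finset.sum_add_distrib]
    exact Finset.sum_congr rfl fun y _ => by ring
  rw [h3, h4]
  have h5 : 4 * Gam2 G f g x = 2 * laplacian G (Gam G f g) x - 2 * Gam G f (laplacian G g) x
      - 2 * Gam G g (laplacian G f) x := by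
    rw [Gam2]; ring
  rw [h5, h1, h2, h2]
  ring

theorem CD_top_iff (K : ℝ) : CD G K ⊤ ↔ ∀ x f, K * Gam G f f x ≤ Gam2 G f f x := by
  simp [CD, CDAt]

/-- A null vector of the nonnegative quadratic form `Γ₂ - K Γ` lies in its kernel. -/
theorem Gam2_eq_of_Gam2_self_eq {K : ℝ} (hCD : CD G K ⊤) {f : V → ℝ} {x : V}
    (hf : Gam2 G f f x = K * Gam G f f x) (g : V → ℝ) : Gam2 G f g x = K * Gam G f g x := by
  rw [CD_top_iff] at hCD
  set b := Gam2 G f g x - K * Gam G f g x with hb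
  set c := Gam2 G g g x - K * Gam G g g x with hc
  have hc0 : 0 ≤ c := sub_nonneg.2 (hCD x g)
  have key : ∀ t : ℝ, 0 ≤ 2 * t * b + t ^ 2 * c := by
    intro t
    have h := hCD x (f + t • g)
    simp only [Gam_add_left, Gam_add_right, Gam_smul_left, Gam_smul_right, Gam2_add_left,
      Gam2_add_right, Gam2_smul_left, Gam2_smul_right, Pi.add_apply, Pi.smul_apply, smul_eq_mul,
      Gam_comm G g f, Gam2_comm G g f] at h
    rw [hb, hc]
    linarith
  -- The minimiser would be `-b / c`, but `c` may vanish. With `c + 1` the value is still negative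
  -- unless `b = 0`.
  have h := key (-b / (c + 1))
  have hc1 : 0 < c + 1 := by linarith
  have e : 2 * (-b / (c + 1)) * b + (-b / (c + 1)) ^ 2 * c =
      -(b ^ 2 * (c + 2)) / (c + 1) ^ 2 := by
    field_simp
    ring
  rw [e, neg_div, le_neg, neg_zero] at h
  have h2 : b ^ 2 * (c + 2) ≤ 0 := by
    by_contra! hlt
    exact absurd h (not_le.2 (by positivity))
  have h3 : b ^ 2 = 0 := le_antisymm (by nlinarith [sq_nonneg b]) (sq_nonneg b)
  have := pow_eq_zero_iff two_ne_zero |>.1 h3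
  linarith

/-- Pair the null vector with the Dirac mass at `z`. Since `z` is neither `x` nor a neighbour of
`x`, all first-order terms vanish and only the paths from `x` to `z` of length two contribute. -/
theorem sum_common_neighbors_eq_zero [DecidableEq V] {K : ℝ} (hCD : CD G K ⊤) {f : V → ℝ} {x z : V}
    (hf : Gam2 G f f x = K * Gam G f f x) (hzx : z ≠ x) (hadj : ¬ G.Adj x z) :
    ∑ y ∈ G.neighborFinset x ∩ G.neighborFinset z, (f z - 2 * f y + f x) = 0 := by
  have h := Gam2_eq_of_Gam2_self_eq G hCD hf (Pi.single z 1)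
  have hx : (Pi.single z 1 : V → ℝ) x = 0 := Pi.single_eq_of_ne hzx.symm _
  have hy : ∀ y ∈ G.neighborFinset x, (Pi.single z 1 : V → ℝ) y = 0 := by
    intro y hy
    refine Pi.single_eq_of_ne ?_ _
    rintro rfl
    exact hadj (by simpa using hy)
  have h0 : Gam G f (Pi.single z 1) x = 0 := by
    rw [Gam_eq, Finset.sum_eq_zero, zero_div]
    intro y hy'
    rw [hy y hy', hx]; ring
  have h1 : laplacian G (Pi.single z 1) x = 0 := by
    rw [laplacian, Finset.sum_eq_zero]
    intro y hy'
    rw [hy y hy', hx]; ring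
  have h2 := four_mul_Gam2 G f (Pi.single z 1) x
  rw [h, h0, h1, Finset.sum_eq_zero (fun y hy' => by rw [hy y hy', hx]; ring :
    ∀ y ∈ G.neighborFinset x, (G.degree x + G.degree y : ℝ) * ((f y - f x) *
      ((Pi.single z 1 : V → ℝ) y - (Pi.single z 1 : V → ℝ) x)) = 0)] at h2
  have h3 : ∀ y ∈ G.neighborFinset x, ∑ w ∈ G.neighborFinset y,
      (f w - 2 * f y + f x) * ((Pi.single z 1 : V → ℝ) w - 2 * (Pi.single z 1 : V → ℝ) y
        + (Pi.single z 1 : V → ℝ) x) =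
      if y ∈ G.neighborFinset z then f z - 2 * f y + f x else 0 := by
    intro y hy'
    rw [hy y hy', hx]
    have e : z ∈ G.neighborFinset y ↔ y ∈ G.neighborFinset z := by
      simp only [SimpleGraph.mem_neighborFinset, G.adj_comm]
    simp [Pi.single_apply, -SimpleGraph.mem_neighborFinset, e]
  rw [Finset.sum_congr rfl h3, ← Finset.sum_filter, Finset.filter_mem_eq_inter] at h2
  linarith

end Basic
-- Square-summable eigenfunctions under CD(K,∞)
section SquareSummable

variable {V : Type*} (G : SimpleGraph V) [G.LocallyFinite]

/-- The Laplacian of a summable function on a graph of bounded degree has sum zero. -/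
theorem summable_laplacian {D : ℕ} (hD : ∀ x, G.degree x ≤ D) {h : V → ℝ} (hh : Summable h) :
    Summable (laplacian G h) ∧ ∑' x, laplacian G h x = 0 := by
  classical
  -- The rows of `F` sum to `degree * h` and its columns to the neighbour sums of `h`. Bounded
  -- degree makes `F` summable, so the two totals agree.
  let F : V × V → ℝ := fun p => if G.Adj p.1 p.2 then h p.1 else 0
  have row : ∀ (x : V) (c : V → ℝ), (HasSum (fun y => if G.Adj x y then c y else 0)
      (∑ y ∈ G.neighborFinset x, c y)) := by
    intro x c
    have := hasSum_sum_of_ne_finset_zero (L := .unconditional V) (s := G.neighborFinset x)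
      (f := fun y => if G.Adj x y then c y else 0) (fun y hy => by
        rw [if_neg]; simpa using hy)
    rwa [Finset.sum_congr rfl (fun y hy => if_pos (by simpa using hy) : ∀ y ∈ G.neighborFinset x,
      (if G.Adj x y then c y else 0) = c y)] at this
  have rowF : ∀ x, HasSum (fun y => F (x, y)) (G.degree x * h x) := by
    intro x
    have := row x (fun _ => h x)
    simpa [F] using this
  have hdeg : Summable fun x => (G.degree x : ℝ) * |h x| := by
    refine Summable.of_nonneg_of_le (fun x => by positivity) (fun x => ?_) (hh.abs.mul_left (D : ℝ))
    exact mul_le_mul_of_nonneg_right (by exact_mod_cast hD x) (abs_nonneg _)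
  have hF : Summable F := by
    rw [← summable_abs_iff]
    have hrow : ∀ x, HasSum (fun y => |F (x, y)|) (G.degree x * |h x|) := by
      intro x
      have := row x (fun _ => |h x|)
      have e : (fun y => |F (x, y)|) = fun y => if G.Adj x y then |h x| else 0 := by
        funext y
        by_cases hxy : G.Adj x y <;> simp [F, hxy]
      rw [e]
      simpa using this
    rw [summable_prod_of_nonneg (fun _ => abs_nonneg _)]
    refine ⟨fun x => (hrow x).summable, ?_⟩
    simpa only [(hrow _).tsum_eq] using hdeg
  have hF' : Summable fun p : V × V => F p.swap := hF.prod_symm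
  have col : ∀ x, HasSum (fun y => F (y, x)) (∑ y ∈ G.neighborFinset x, h y) := by
    intro x
    have := row x h
    simpa [F, G.adj_comm] using this
  have e1 := hF.hasSum.prod_fiberwise rowF
  have e2 := hF'.hasSum.prod_fiberwise (g := fun x => ∑ y ∈ G.neighborFinset x, h y) col
  rw [show ∑' p : V × V, F p.swap = ∑' p, F p from (Equiv.prodComm V V).tsum_eq F] at e2
  have e3 := e2.sub e1
  have e4 : laplacian G h = fun x => ∑ y ∈ G.neighborFinset x, h y - G.degree x * h x := by
    funext x
    simp [laplacian, Finset.sum_sub_distrib]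
  rw [e4]
  exact ⟨e3.summable, by rw [e3.tsum_eq, sub_self]⟩

/-- Summability makes superlevel sets at positive heights finite, so a maximum is attained and the
maximum principle applies. -/
theorem eq_of_laplacian_eq_zero (hG : G.Connected) {h : V → ℝ} (hs : Summable h)
    (h0 : ∀ x, 0 ≤ h x) (hl : ∀ x, laplacian G h x = 0) (x y : V) : h x = h y := by
  by_cases hz : ∃ x, 0 < h x
  · obtain ⟨x₀, hx₀⟩ := hz
    have hfin : {y | h x₀ ≤ h y}.Finite := by
      have := hs.tendsto_cofinite_zero.eventually (gt_mem_nhds hx₀)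
      simpa [Filter.eventually_cofinite] using this
    obtain ⟨m, hm, hmax⟩ := Set.exists_max_image _ h hfin ⟨x₀, le_refl (h x₀)⟩
    have hmax' : ∀ y, h y ≤ h m := by
      intro y
      rcases le_total (h x₀) (h y) with hy | hy
      · exact hmax y hy
      · exact hy.trans hm
    have key : ∀ y, h y = h m := by
      refine forall_of_adj hG (x := m) rfl fun y z hyz hy => ?_
      have h1 := hl y
      rw [laplacian, Finset.sum_eq_zero_iff_of_nonpos] at h1
      · have := h1 z (by simpa using hyz)
        linarith
      · intro w _
        linarith [hmax' w]
    rw [key x, key y]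
  · push Not at hz
    rw [le_antisymm (hz x) (h0 x), le_antisymm (hz y) (h0 y)]

theorem summable_sq_of_mem_eigenspace {μ : ℝ} {f : V → ℝ} (hf : f ∈ eigenspace G μ) :
    Summable (f * f) := by
  have h := (memℓp_gen_iff (p := 2) (by norm_num)).1 hf.1
  refine h.congr fun x => ?_
  simp [sq]

theorem laplacian_of_mem_eigenspace {μ : ℝ} {f : V → ℝ} (hf : f ∈ eigenspace G μ) :
    laplacian G f = (-μ) • f := by
  funext x
  have := hf.2 x
  simp only [Pi.smul_apply, smul_eq_mul]
  linarith

theorem Gam2_of_mem_eigenspace {μ : ℝ} {f : V → ℝ} (hf : f ∈ eigenspace G μ) (x : V) :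
    Gam2 G f f x = laplacian G (Gam G f f) x / 2 + μ * Gam G f f x := by
  rw [Gam2, laplacian_of_mem_eigenspace G hf, Gam_smul_right]
  simp only [Pi.smul_apply, smul_eq_mul]
  ring

theorem summable_Gam_of_mem_eigenspace {D : ℕ} (hD : ∀ x, G.degree x ≤ D) {μ : ℝ} {f : V → ℝ}
    (hf : f ∈ eigenspace G μ) : Summable (Gam G f f) := by
  have h1 := summable_sq_of_mem_eigenspace G hf
  have h2 := (((summable_laplacian G hD h1).1.add (h1.mul_left (2 * μ))).mul_right (1 / 2))
  refine h2.congr fun x => ?_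
  rw [Gam, laplacian_of_mem_eigenspace G hf]
  simp only [Pi.smul_apply, smul_eq_mul, Pi.mul_apply]
  ring

/-- Integrated Bochner: CD gives `(K - μ) Γ ≤ ΔΓ / 2`, whose right side sums to zero, so `Γ`
vanishes. -/
theorem eq_of_mem_eigenspace_of_lt (hG : G.Connected) {D : ℕ} (hD : ∀ x, G.degree x ≤ D) {K μ : ℝ}
    (hCD : CD G K ⊤) (hμ : μ < K) {f : V → ℝ} (hf : f ∈ eigenspace G μ) (x y : V) : f x = f y := by
  rw [CD_top_iff] at hCD
  have hs := summable_Gam_of_mem_eigenspace G hD hf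
  obtain ⟨h1, h2⟩ := summable_laplacian G hD hs
  have h3 : ∀ x, (K - μ) * Gam G f f x ≤ laplacian G (Gam G f f) x / 2 := by
    intro x
    have := hCD x f
    rw [Gam2_of_mem_eigenspace G hf] at this
    linarith
  have h4 := Summable.tsum_le_tsum h3 (hs.mul_left _) (h1.div_const 2)
  rw [tsum_mul_left, tsum_div_const, h2, zero_div] at h4
  have h5 : ∑' x, Gam G f f x = 0 :=
    le_antisymm (by nlinarith [sub_pos.2 hμ]) (tsum_nonneg (Gam_self_nonneg G f))
  have h6 := (hasSum_zero_iff_of_nonneg (Gam_self_nonneg G f)).1 (h5 ▸ hs.hasSum)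
  have : ∀ z, f z = f x := forall_of_adj hG (x := x) rfl fun y z hyz hy => by
    rw [eq_of_Gam_self_eq_zero G (congrFun h6 y) hyz, hy]
  exact (this y).symm

/-- Equality case: `ΔΓ ≥ 0` has sum zero, so `Γ` is harmonic and summable, hence constant, and no
slack is left in CD. -/
theorem Gam_eq_of_mem_eigenspace (hG : G.Connected) {D : ℕ} (hD : ∀ x, G.degree x ≤ D) {K : ℝ}
    (hCD : CD G K ⊤) {f : V → ℝ} (hf : f ∈ eigenspace G K) :
    (∀ x, Gam2 G f f x = K * Gam G f f x) ∧ ∀ x y, Gam G f f x = Gam G f f y := by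
  rw [CD_top_iff] at hCD
  have hs := summable_Gam_of_mem_eigenspace G hD hf
  obtain ⟨h1, h2⟩ := summable_laplacian G hD hs
  have h3 : ∀ x, 0 ≤ laplacian G (Gam G f f) x := by
    intro x
    have := hCD x f
    rw [Gam2_of_mem_eigenspace G hf] at this
    linarith
  have h6 := (hasSum_zero_iff_of_nonneg h3).1 (h2 ▸ h1.hasSum)
  refine ⟨fun x => ?_, eq_of_laplacian_eq_zero G hG hs (Gam_self_nonneg G f) (congrFun h6)⟩
  rw [Gam2_of_mem_eigenspace G hf, congrFun h6 x]
  simp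

/-- A constant `Γ` that vanishes once vanishes everywhere, so `K f = -Δf = 0`. This makes the
gradient at a single vertex injective on the eigenspace. -/
theorem eq_zero_of_mem_eigenspace (hG : G.Connected) {D : ℕ} (hD : ∀ x, G.degree x ≤ D) {K : ℝ}
    (hK : 0 < K) (hCD : CD G K ⊤) {f : V → ℝ} (hf : f ∈ eigenspace G K) {x : V}
    (hx : ∀ y, G.Adj x y → f y = f x) : f = 0 := by
  have h0 : Gam G f f x = 0 := by
    rw [Gam_eq, Finset.sum_eq_zero, zero_div]
    intro y hy
    rw [hx y (by simpa using hy)]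
    ring
  have h1 := fun y => (Gam_eq_of_mem_eigenspace G hG hD hCD hf).2 y x
  funext y
  have h2 := hf.2 y
  rw [laplacian, Finset.sum_eq_zero, neg_zero] at h2
  · simpa [hK.ne'] using h2.symm
  · intro z hz
    rw [eq_of_Gam_self_eq_zero G ((h1 y).trans h0) (by simpa using hz), sub_self]

theorem iSup_eigenspace_Iio_le_span_one (hG : G.Connected) {D : ℕ} (hD : ∀ x, G.degree x ≤ D) {K : ℝ}
    (hCD : CD G K ⊤) : (⨆ μ : Set.Iio K, eigenspace G μ) ≤ Submodule.span ℝ {fun _ => (1 : ℝ)} := by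
  obtain ⟨x⟩ := hG.nonempty
  refine iSup_le fun μ f hf => Submodule.mem_span_singleton.2 ⟨f x, ?_⟩
  funext y
  simpa using eq_of_mem_eigenspace_of_lt G hG hD hCD μ.2 hf x y

/-- Constants account for at most one of the `D + 1` dimensions up to `K`. -/
theorem le_rank_eigenspace (hG : G.Connected) {D : ℕ} (hD : ∀ x, G.degree x ≤ D) {K : ℝ}
    (hCD : CD G K ⊤) (h : IsOrderedEigenvalue G D K) :
    (D : Cardinal) ≤ Module.rank ℝ (eigenspace G K) := by
  have h1 : (⨆ μ : Set.Iic K, eigenspace G μ) ≤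
      Submodule.span ℝ {fun _ => (1 : ℝ)} ⊔ eigenspace G K := by
    refine iSup_le fun μ => ?_
    rcases (show μ.1 ≤ K from μ.2).lt_or_eq with hμ | hμ
    · exact ((le_iSup (fun μ : Set.Iio K => eigenspace G μ) ⟨μ.1, hμ⟩).trans
        (iSup_eigenspace_Iio_le_span_one G hG hD hCD)).trans le_sup_left
    · rw [hμ]
      exact le_sup_right
  have h2 := (h.2.trans_le (Submodule.rank_mono h1)).trans_le
    (Submodule.rank_add_le_rank_add_rank _ _)
  have h3 : Module.rank ℝ (Submodule.span ℝ {fun _ : V => (1 : ℝ)}) ≤ 1 := by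
    simpa using rank_span_le (R := ℝ) {fun _ : V => (1 : ℝ)}
  have h4 := h2.trans_le (add_le_add_left h3 _)
  rw [add_comm] at h4
  by_contra! hlt
  obtain ⟨n, hn⟩ := Cardinal.lt_aleph0.1 (hlt.trans Cardinal.natCast_lt_aleph0)
  rw [hn] at h4 hlt
  norm_cast at h4 hlt
  lia

end SquareSummable
-- Rigidity: multiplicity at least `D` forces a hypercube
/-- A connected graph whose edges are given by commuting involutions, each changing one coordinate
of a set-valued labelling, is a hypercube. -/
theorem isHypercube_of_flips {V : Type*} {G : SimpleGraph V} (hG : G.Connected) {D : ℕ}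
    (φ : Fin D → V → V) (c : V → Finset (Fin D))
    (hadj : ∀ z y, G.Adj z y ↔ ∃ i, y = φ i z)
    (hcomm : ∀ i j z, φ i (φ j z) = φ j (φ i z)) (hinv : ∀ i z, φ i (φ i z) = z)
    (hc : ∀ i z, c (φ i z) = symmDiff (c z) {i}) {x₀ : V} (hx₀ : c x₀ = ∅) :
    IsHypercube G D := by
  have : LeftCommutative φ := ⟨fun i j z => hcomm i j z⟩
  -- The inverse of `c` applies to `x₀` the flips indexed by `S`. The order is immaterial because
  -- they commute.
  let ψ : Finset (Fin D) → V := fun S => S.val.foldr φ x₀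
  have hψ : ∀ i S, i ∉ S → ψ (insert i S) = φ i (ψ S) := by
    intro i S hi
    simp only [ψ]
    rw [Finset.insert_val_of_notMem hi, Multiset.foldr_cons]
  have hψ' : ∀ i S, ψ (symmDiff S {i}) = φ i (ψ S) := by
    intro i S
    by_cases hi : i ∈ S
    · have e : symmDiff S {i} = S.erase i := by
        ext j
        simp only [Finset.mem_symmDiff, Finset.mem_singleton, Finset.mem_erase]
        grind
      have := hψ i (S.erase i) (Finset.notMem_erase i S)
      rw [Finset.insert_erase hi] at this
      rw [e, this, hinv]
    · have e : symmDiff S {i} = insert i S := by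
        ext j
        simp only [Finset.mem_symmDiff, Finset.mem_singleton, Finset.mem_insert]
        grind
      rw [e, hψ i S hi]
  have hcψ : ∀ S, c (ψ S) = S := by
    intro S
    induction S using Finset.induction_on with
    | empty => exact hx₀
    | insert i S hi ih =>
      rw [hψ i S hi, hc, ih]
      ext j
      simp only [Finset.mem_symmDiff, Finset.mem_singleton, Finset.mem_insert]
      grind
  have hψc : ∀ z, ψ (c z) = z := by
    refine forall_of_adj hG (x := x₀) (by rw [hx₀]; rfl) fun y z hyz hy => ?_
    obtain ⟨i, rfl⟩ := (hadj y z).1 hyz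
    rw [hc, hψ', hy]
  refine ⟨⟨⟨c, ψ, hψc, hcψ⟩, fun {a b} => ?_⟩⟩
  change (symmDiff (c a) (c b)).card = 1 ↔ _
  rw [Finset.card_eq_one, hadj]
  refine exists_congr fun i => ⟨fun h => ?_, fun h => ?_⟩
  · rw [← hψc b, ← symmDiff_symmDiff_cancel_left (c a) (c b), h, hψ', hψc]
  · rw [h, hc, symmDiff_symmDiff_cancel_left]

section Rigidity

variable {V : Type*} (G : SimpleGraph V) [G.LocallyFinite]

/-- If the eigenspace of `K` has dimension at least the maximal degree, then its gradients at a
vertex are arbitrary. -/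
theorem exists_mem_eigenspace_gradient (hG : G.Connected) {D : ℕ} (hD : ∀ x, G.degree x ≤ D) {K : ℝ}
    (hK : 0 < K) (hCD : CD G K ⊤) (hr : (D : Cardinal) ≤ Module.rank ℝ (eigenspace G K)) (x : V) :
    G.degree x = D ∧ ∀ a : V → ℝ, ∃ f ∈ eigenspace G K, ∀ y, G.Adj x y → f y - f x = a y := by
  let L : eigenspace G K →ₗ[ℝ] (G.neighborSet x → ℝ) :=
    { toFun := fun f y => f.1 y - f.1 x
      map_add' := fun f g => by
        funext y
        simp only [Submodule.coe_add, Pi.add_apply]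
        ring
      map_smul' := fun c f => by
        funext y
        simp only [Submodule.coe_smul, Pi.smul_apply, smul_eq_mul, RingHom.id_apply]
        ring }
  have hL : Function.Injective L := by
    rw [← LinearMap.ker_eq_bot, LinearMap.ker_eq_bot']
    intro f hf
    refine Subtype.ext (eq_zero_of_mem_eigenspace G hG hD hK hCD f.2 (x := x) fun y hy => ?_)
    exact sub_eq_zero.1 (congrFun hf ⟨y, hy⟩)
  have h1 : Module.rank ℝ (eigenspace G K) ≤ G.degree x := by
    have := LinearMap.rank_le_of_injective L hL
    rwa [rank_fun', SimpleGraph.card_neighborSet_eq_degree] at this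
  have h2 : G.degree x = D := le_antisymm (hD x) (by exact_mod_cast hr.trans h1)
  have : FiniteDimensional ℝ (eigenspace G K) := Module.Finite.of_injective L hL
  have h3 : Module.finrank ℝ (eigenspace G K) = Module.finrank ℝ (G.neighborSet x → ℝ) := by
    rw [Module.finrank_fintype_fun_eq_card, SimpleGraph.card_neighborSet_eq_degree]
    refine Module.finrank_eq_of_rank_eq (le_antisymm h1 (h2 ▸ hr))
  refine ⟨h2, fun a => ?_⟩
  obtain ⟨f, hf⟩ := (LinearMap.injective_iff_surjective_of_finrank_eq_finrank h3).1 hL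
    fun y => a y
  exact ⟨f.1, f.2, fun y hy => congrFun hf ⟨y, hy⟩⟩

/-- Gradients of eigenfunctions for `K` have constant inner products. -/
theorem sum_gradient_mul_eq (hG : G.Connected) {D : ℕ} (hD : ∀ x, G.degree x ≤ D) {K : ℝ}
    (hCD : CD G K ⊤) {f g : V → ℝ} (hf : f ∈ eigenspace G K) (hg : g ∈ eigenspace G K) (x y : V) :
    ∑ z ∈ G.neighborFinset x, (f z - f x) * (g z - g x) =
      ∑ z ∈ G.neighborFinset y, (f z - f y) * (g z - g y) := by
  have h1 := (Gam_eq_of_mem_eigenspace G hG hD hCD (add_mem hf hg)).2 x y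
  have h2 := (Gam_eq_of_mem_eigenspace G hG hD hCD hf).2 x y
  have h3 := (Gam_eq_of_mem_eigenspace G hG hD hCD hg).2 x y
  simp only [Gam_add_left, Gam_add_right, Pi.add_apply, Gam_comm G g f] at h1
  have h4 : Gam G f g x = Gam G f g y := by linarith
  rw [Gam_eq, Gam_eq] at h4
  linarith

/-- An edge with jump ±1 exhausts a gradient of norm one. -/
theorem eq_of_sum_sq_eq_one {f : V → ℝ} {x y : V}
    (h : ∑ z ∈ G.neighborFinset x, (f z - f x) * (f z - f x) = 1) (hxy : G.Adj x y)
    (hy : (f y - f x) ^ 2 = 1) {z : V} (hxz : G.Adj x z) (hzy : z ≠ y) : f z = f x := by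
  classical
  have hy' : y ∈ G.neighborFinset x := by simpa using hxy
  rw [← Finset.add_sum_erase _ _ hy'] at h
  have h0 : ∑ z ∈ (G.neighborFinset x).erase y, (f z - f x) * (f z - f x) = 0 := by linarith
  rw [Finset.sum_eq_zero_iff_of_nonneg fun z _ => mul_self_nonneg _] at h0
  have := h0 z (Finset.mem_erase.2 ⟨hzy, by simpa using hxz⟩)
  exact sub_eq_zero.1 (mul_self_eq_zero.1 this)

theorem sum_gradient_eq_of_single {f : V → ℝ} {x y : V} (hxy : G.Adj x y)
    (h : ∀ z, G.Adj x z → z ≠ y → f z = f x) (g : V → ℝ) :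
    ∑ z ∈ G.neighborFinset x, (f z - f x) * g z = (f y - f x) * g y := by
  refine Finset.sum_eq_single_of_mem y (by simpa using hxy) fun z hz hzy => ?_
  rw [h z (by simpa using hz) hzy]
  ring

/-- Rigidity: if the eigenvalue `K` of a graph with `CD(K,∞)` has multiplicity at least the maximal
degree, then the graph is a hypercube. -/
theorem isHypercube_of_le_rank [Nontrivial V] (hG : G.Connected) {D : ℕ}
    (hD : ∀ x, G.degree x ≤ D) {K : ℝ} (hK : 0 < K) (hCD : CD G K ⊤)
    (hr : (D : Cardinal) ≤ Module.rank ℝ (eigenspace G K)) : IsHypercube G D := by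
  classical
  have hgrad := exists_mem_eigenspace_gradient G hG hD hK hCD hr
  have hdeg := fun x => (hgrad x).1
  have hconst := fun {f g : V → ℝ} => sum_gradient_mul_eq G hG hD hCD (f := f) (g := g)
  have lap : ∀ {f}, f ∈ eigenspace G K → ∀ x, ∑ z ∈ G.neighborFinset x, (f z - f x) * 1 =
      - K * f x := by
    intro f hf x
    have := hf.2 x
    rw [laplacian] at this
    simp only [mul_one]
    linarith
  -- The gradient at `x` is the indicator of one edge. Its norm is 1 there, hence at every vertex.
  have unit : ∀ x y, G.Adj x y → ∃ f ∈ eigenspace G K, f y = f x + 1 ∧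
      (∀ z, G.Adj x z → z ≠ y → f z = f x) ∧
      ∀ z, ∑ w ∈ G.neighborFinset z, (f w - f z) * (f w - f z) = 1 := by
    intro x y hxy
    obtain ⟨f, hf, hfx⟩ := (hgrad x).2 (Pi.single y 1)
    have h1 : f y = f x + 1 := by
      have := hfx y hxy
      rw [Pi.single_eq_same] at this
      linarith
    have h2 : ∀ z, G.Adj x z → z ≠ y → f z = f x := by
      intro z hxz hzy
      have := hfx z hxz
      rw [Pi.single_eq_of_ne hzy] at this
      linarith
    refine ⟨f, hf, h1, h2, fun z => ?_⟩
    rw [hconst hf hf z x, sum_gradient_eq_of_single G hxy h2 (fun z => f z - f x), h1]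
    ring
  have back : ∀ {x y} {f : V → ℝ}, G.Adj x y → f y = f x + 1 →
      (∀ z, ∑ w ∈ G.neighborFinset z, (f w - f z) * (f w - f z) = 1) →
      ∀ w, G.Adj y w → w ≠ x → f w = f y := by
    intro x y f hxy h1 h w hyw hwx
    exact eq_of_sum_sq_eq_one G (h y) hxy.symm (by rw [h1]; ring) hyw hwx
  -- Here `Δf` is 1 at `x` and -1 at `y`, while `f y - f x = 1`.
  have hK2 : K = 2 := by
    obtain ⟨x, x', hne⟩ := exists_pair_ne V
    obtain ⟨y, hxy⟩ := hG.preconnected.exists_adj_of_nontrivial x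
    obtain ⟨f, hf, h1, h2, h3⟩ := unit x y hxy
    have e1 := lap hf x
    rw [sum_gradient_eq_of_single G hxy h2 (fun _ => 1)] at e1
    have e2 := lap hf y
    rw [sum_gradient_eq_of_single G hxy.symm (back hxy h1 h3) (fun _ => 1)] at e2
    rw [h1] at e1 e2
    linarith
  have tri : ∀ {x y w}, G.Adj x y → G.Adj x w → ¬ G.Adj y w := by
    intro x y w hxy hxw hyw
    obtain ⟨f, hf, h1, h2, h3⟩ := unit x y hxy
    have := back hxy h1 h3 w hyw hxw.ne'
    have := h2 w hxw hyw.ne'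
    linarith
  -- The relation between `y` and `w` is used twice. For the unit function of the edge from `y` to
  -- `x`, the common neighbour `x` contributes -1 and every other one +1, so there are exactly two.
  -- For arbitrary eigenfunctions it then becomes the parallelogram identity.
  have square : ∀ {x y w}, G.Adj x y → G.Adj x w → y ≠ w → ∃ u, u ≠ x ∧ G.Adj y u ∧ G.Adj w u ∧
      ∀ f ∈ eigenspace G K, f u + f x = f y + f w := by
    intro x y w hxy hxw hyw
    have hC : ∀ f ∈ eigenspace G K, ∑ u ∈ G.neighborFinset y ∩ G.neighborFinset w,
        (f w - 2 * f u + f y) = 0 := fun f hf =>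
      sum_common_neighbors_eq_zero G hCD ((Gam_eq_of_mem_eigenspace G hG hD hCD hf).1 y) hyw.symm
        (tri hxy hxw)
    have hx : x ∈ G.neighborFinset y ∩ G.neighborFinset w := by simp [hxy.symm, hxw.symm]
    have hcard : (G.neighborFinset y ∩ G.neighborFinset w).card = 2 := by
      obtain ⟨f, hf, h1, h2, h3⟩ := unit y x hxy.symm
      have h4 := back hxy.symm h1 h3 w hxw hyw.symm
      have h5 := hC f hf
      rw [← Finset.add_sum_erase _ _ hx, Finset.sum_congr rfl (g := fun _ => (1 : ℝ))] at h5
      · rw [Finset.sum_const, Finset.card_erase_of_mem hx, nsmul_eq_mul, h4, h1,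
          Nat.cast_pred (Finset.card_pos.2 ⟨x, hx⟩)] at h5
        have : ((G.neighborFinset y ∩ G.neighborFinset w).card : ℝ) = 2 := by linarith
        exact_mod_cast this
      · intro u hu
        simp only [Finset.mem_erase, Finset.mem_inter, SimpleGraph.mem_neighborFinset] at hu
        rw [h2 u hu.2.1 hu.1, h4, h1]
        ring
    obtain ⟨u, hu⟩ := Finset.card_eq_one.1
      (show ((G.neighborFinset y ∩ G.neighborFinset w).erase x).card = 1 by
        rw [Finset.card_erase_of_mem hx, hcard])
    have hu' : u ∈ (G.neighborFinset y ∩ G.neighborFinset w).erase x := by simp [hu]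
    simp only [Finset.mem_erase, Finset.mem_inter, SimpleGraph.mem_neighborFinset] at hu'
    refine ⟨u, hu'.1, hu'.2.1, hu'.2.2, fun f hf => ?_⟩
    have := hC f hf
    rw [← Finset.add_sum_erase _ _ hx, hu, Finset.sum_singleton] at this
    linarith
  obtain ⟨x₀⟩ := hG.nonempty
  have enum : Fintype.card (Fin D) = Fintype.card (G.neighborSet x₀) := by
    rw [Fintype.card_fin, SimpleGraph.card_neighborSet_eq_degree, hdeg]
  let e := Fintype.equivOfCardEq enum
  choose f hfE hfy hfo hf1 using fun i => unit x₀ (e i) (e i).2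
  -- The parallelogram identity carries a unit jump across a square to the opposite edge, so its
  -- existence spreads by connectedness.
  have step : ∀ i z, ∃ y, G.Adj z y ∧ (f i y - f i z) ^ 2 = 1 := by
    intro i
    refine forall_of_adj hG (x := x₀) ⟨e i, (e i).2, by rw [hfy]; ring⟩ fun z w hzw ⟨y, hzy, hy⟩ => ?_
    by_cases hyw : y = w
    · exact ⟨z, hzw.symm, by rw [← hyw, ← hy]; ring⟩
    · obtain ⟨u, -, -, hwu, hu⟩ := square hzy hzw hyw
      refine ⟨u, hwu, ?_⟩
      rw [← hy]
      have := hu _ (hfE i)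
      rw [show f i u - f i w = f i y - f i z by linarith]
  choose φ hφ hφ1 using step
  have other : ∀ {i z y}, G.Adj z y → y ≠ φ i z → f i y = f i z := fun {i z y} h1 h2 =>
    eq_of_sum_sq_eq_one G (hf1 i z) (hφ i z) (hφ1 i z) h1 h2
  -- Only one edge contributes to `Δf = -2f`.
  have flip : ∀ i z, f i (φ i z) = - f i z := by
    intro i z
    have := lap (hfE i) z
    rw [sum_gradient_eq_of_single G (hφ i z) (fun y h1 h2 => other h1 h2) (fun _ => 1), hK2] at this
    linarith
  have val : ∀ i z, f i z = 1 / 2 ∨ f i z = - (1 / 2) := by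
    intro i z
    have h := hφ1 i z
    rw [flip] at h
    have : (f i z - 1 / 2) * (f i z + 1 / 2) = 0 := by linarith
    rcases mul_eq_zero.1 this with h | h
    · left; linarith
    · right; linarith
  have val0 : ∀ i, f i x₀ = - (1 / 2) := by
    intro i
    rcases val i x₀ with h | h
    · have := hfy i
      rcases val i (e i) with h' | h' <;> linarith
    · exact h
  have uniq : ∀ {i z y}, G.Adj z y → f i y ≠ f i z → y = φ i z := fun h1 h2 => by
    by_contra h
    exact h2 (other h1 h)
  have nz : ∀ i z, f i z ≠ 0 := by
    intro i z h
    rcases val i z with h' | h' <;> rw [h] at h' <;> norm_num at h'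
  -- If two flips agreed at `z`, the gradients of `f i` and `f j` would have inner product `4 * f i
  -- z * f j z ≠ 0` there, but they are orthogonal at `x₀`.
  have inj : ∀ z i j, φ i z = φ j z → i = j := by
    intro z i j h
    by_contra hij
    have h1 := hconst (hfE i) (hfE j) z x₀
    have hne : (e j : V) ≠ e i := fun h => hij (e.injective (Subtype.ext h)).symm
    rw [sum_gradient_eq_of_single G (hφ i z) (fun y h1 h2 => other h1 h2)
      (fun w => f j w - f j z),
      sum_gradient_eq_of_single G (e i).2 (hfo i) (fun w => f j w - f j x₀),
      hfo j (e i) (e i).2 hne.symm, h, flip j z, ← h, flip i z] at h1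
    have := mul_ne_zero (nz i z) (nz j z)
    apply this
    linarith
  have surj : ∀ z y, G.Adj z y → ∃ i, y = φ i z := by
    intro z y hzy
    have h1 : Finset.univ.image (fun i => φ i z) = G.neighborFinset z := by
      refine Finset.eq_of_subset_of_card_le ?_ ?_
      · intro w hw
        obtain ⟨i, -, rfl⟩ := Finset.mem_image.1 hw
        simpa using hφ i z
      · rw [Finset.card_image_of_injective _ fun i j h => inj z i j h,
          SimpleGraph.card_neighborFinset_eq_degree, hdeg, Finset.card_univ, Fintype.card_fin]
    have h2 : y ∈ G.neighborFinset z := by simpa using hzy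
    rw [← h1] at h2
    obtain ⟨i, -, rfl⟩ := Finset.mem_image.1 h2
    exact ⟨i, rfl⟩
  have stay : ∀ {i j}, i ≠ j → ∀ z, f j (φ i z) = f j z := fun {i j} hij z =>
    other (hφ i z) fun h => hij (inj z i j h)
  have inv : ∀ i z, φ i (φ i z) = z := by
    intro i z
    refine (uniq (hφ i z).symm ?_).symm
    rw [flip]
    intro h
    exact nz i z (by linarith)
  -- The fourth vertex of the square is reached in both orders, as `f i` and `f j` identify its last
  -- edges.
  have comm : ∀ i j z, φ i (φ j z) = φ j (φ i z) := by
    intro i j z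
    by_cases hij : i = j
    · rw [hij]
    · obtain ⟨u, -, h1, h2, hu⟩ := square (hφ i z) (hφ j z) fun h => hij (inj z i j h)
      have ei : u = φ i (φ j z) := by
        refine uniq h2 ?_
        have := hu _ (hfE i)
        rw [flip, stay (Ne.symm hij)] at this
        rw [stay (Ne.symm hij)]
        intro h
        exact nz i z (by linarith)
      have ej : u = φ j (φ i z) := by
        refine uniq h1 ?_
        have := hu _ (hfE j)
        rw [flip, stay hij] at this
        rw [stay hij]
        intro h
        exact nz j z (by linarith)
      rw [← ei, ej]
  refine isHypercube_of_flips hG φ (fun z => Finset.univ.filter fun i => 0 < f i z)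
    (fun z y => ⟨surj z y, ?_⟩) comm inv ?_ (x₀ := x₀) ?_
  · rintro ⟨i, rfl⟩
    exact hφ i z
  · intro i z
    ext j
    simp only [Finset.mem_filter, Finset.mem_univ, true_and, Finset.mem_symmDiff,
      Finset.mem_singleton]
    by_cases hij : i = j
    · subst hij
      rw [flip]
      rcases val i z with h | h <;> rw [h] <;> norm_num
    · rw [stay hij]
      simp [Ne.symm hij]
  · refine Finset.filter_eq_empty_iff.2 fun i _ => ?_
    rw [val0]
    norm_num

end Rigidity
-- Curvature, spectrum and diameter of the hypercube
theorem card_le_rank_of_linearIndependent {ι V : Type*} [Fintype ι] {W : Submodule ℝ (V → ℝ)}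
    {v : ι → V → ℝ} (hv : LinearIndependent ℝ v) (hW : ∀ i, v i ∈ W) :
    (Fintype.card ι : Cardinal) ≤ Module.rank ℝ W := by
  have h : LinearIndependent ℝ fun i => (⟨v i, hW i⟩ : W) :=
    LinearIndependent.of_comp W.subtype hv
  simpa using h.cardinal_lift_le_rank

section Cube

variable {V : Type*} (G : SimpleGraph V) [G.LocallyFinite]

/-- The coordinate flips of a hypercube, together with its labelling by subsets. -/
theorem IsHypercube.exists_flips {V : Type*} {G : SimpleGraph V} {D : ℕ} (h : IsHypercube G D) :
    ∃ (c : V ≃ Finset (Fin D)) (φ : Fin D → V → V), (∀ i z, c (φ i z) = symmDiff (c z) {i}) ∧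
      (∀ z y, G.Adj z y ↔ ∃ i, y = φ i z) ∧ (∀ i j z, φ i (φ j z) = φ j (φ i z)) ∧
      ∀ i z, φ i (φ i z) = z := by
  obtain ⟨e⟩ := h
  have hc : ∀ i z, e (e.symm (symmDiff (e z) {i})) = symmDiff (e z) {i} :=
    fun i z => e.apply_symm_apply _
  refine ⟨e.toEquiv, fun i z => e.symm (symmDiff (e z) {i}), hc, fun z y => ?_, fun i j z => ?_,
    fun i z => ?_⟩
  · rw [← e.map_adj_iff]
    change (symmDiff (e z) (e y)).card = 1 ↔ _
    rw [Finset.card_eq_one]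
    refine exists_congr fun i => ⟨fun h => ?_, fun h => ?_⟩
    · change y = e.symm (symmDiff (e z) {i})
      rw [← h, symmDiff_symmDiff_cancel_left, e.symm_apply_apply]
    · rw [h, hc, symmDiff_symmDiff_cancel_left]
  · apply e.injective
    simp only [hc]
    rw [symmDiff_right_comm]
  · apply e.injective
    simp only [hc]
    rw [symmDiff_symmDiff_cancel_right, e.symm_apply_apply]

variable {D : ℕ} {c : V ≃ Finset (Fin D)} {φ : Fin D → V → V}

theorem flip_injective {V : Type*} {D : ℕ} {c : V ≃ Finset (Fin D)} {φ : Fin D → V → V}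
    (hc : ∀ i z, c (φ i z) = symmDiff (c z) {i}) (z : V) : Function.Injective fun i => φ i z := by
  intro i j h
  have h1 := congrArg c h
  simp only [hc] at h1
  exact Finset.singleton_injective (symmDiff_right_injective _ h1)

theorem sum_neighborFinset_eq_sum_flip (hc : ∀ i z, c (φ i z) = symmDiff (c z) {i})
    (hadj : ∀ z y, G.Adj z y ↔ ∃ i, y = φ i z)
    (z : V) (h : V → ℝ) :
    ∑ y ∈ G.neighborFinset z, h y = ∑ i, h (φ i z) := by
  classical
  have : G.neighborFinset z = Finset.univ.image fun i => φ i z := by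
    ext y
    simp [hadj, eq_comm]
  rw [this, Finset.sum_image fun i _ j _ h => flip_injective hc z h]

theorem degree_eq_of_flips (hc : ∀ i z, c (φ i z) = symmDiff (c z) {i})
    (hadj : ∀ z y, G.Adj z y ↔ ∃ i, y = φ i z)
    (z : V) : G.degree z = D := by
  have := sum_neighborFinset_eq_sum_flip G hc hadj z fun _ => 1
  simp only [Finset.sum_const, SimpleGraph.card_neighborFinset_eq_degree, Finset.card_univ,
    Fintype.card_fin, nsmul_eq_mul, mul_one] at this
  exact_mod_cast this

theorem CD_two_of_flips (hc : ∀ i z, c (φ i z) = symmDiff (c z) {i})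
    (hadj : ∀ z y, G.Adj z y ↔ ∃ i, y = φ i z)
    (hcomm : ∀ i j z, φ i (φ j z) = φ j (φ i z))
    (hinv : ∀ i z, φ i (φ i z) = z) : CD G 2 ⊤ := by
  rw [CD_top_iff]
  intro x f
  have hs := sum_neighborFinset_eq_sum_flip G hc hadj
  have h1 := four_mul_Gam2 G f f x
  have h2 := two_mul_Gam_self G f x
  simp only [degree_eq_of_flips G hc hadj, laplacian, hs, ← Finset.mul_sum] at h1 h2
  set a : Fin D → ℝ := fun i => f (φ i x) - f x with ha
  -- These mixed second differences are symmetric as flips commute, and the diagonal is `-2 * a i`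
  -- as flips are involutions. All other terms of `4Γ₂` cancel, and the diagonal alone gives `4 ∑ a
  -- i ^ 2 = 8Γ`.
  set b : Fin D → Fin D → ℝ := fun i j => f (φ j (φ i x)) - f (φ i x) - f (φ j x) + f x with hb
  have hbs : ∀ i j, b i j = b j i := fun i j => by
    simp only [hb]
    rw [hcomm]
    ring
  have hbd : ∀ i, b i i = -2 * a i := fun i => by
    simp only [hb, ha]
    rw [hinv]
    ring
  have e1 : ∑ i, ∑ j, (f (φ j (φ i x)) - 2 * f (φ i x) + f x) *
      (f (φ j (φ i x)) - 2 * f (φ i x) + f x) =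
      ∑ i, ∑ j, b i j ^ 2 + ∑ i, ∑ j, (a j - a i) ^ 2 + 2 * ∑ i, ∑ j, b i j * a j
        - 2 * ∑ i, ∑ j, b i j * a i := by
    simp only [Finset.mul_sum, ← Finset.sum_add_distrib, ← Finset.sum_sub_distrib]
    refine Finset.sum_congr rfl fun i _ => Finset.sum_congr rfl fun j _ => ?_
    simp only [ha, hb]
    ring
  have e2 : ∑ i, ∑ j, b i j * a j = ∑ i, ∑ j, b i j * a i := by
    rw [Finset.sum_comm]
    exact Finset.sum_congr rfl fun i _ => Finset.sum_congr rfl fun j _ => by rw [hbs]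
  have e3 : ∑ i, ∑ j, (a j - a i) ^ 2 = 2 * D * ∑ i, a i ^ 2 - 2 * (∑ i, a i) ^ 2 := by
    have : ∀ i j, (a j - a i) ^ 2 = a j ^ 2 + a i ^ 2 - 2 * (a i * a j) := fun i j => by ring
    simp only [this, Finset.sum_sub_distrib, Finset.sum_add_distrib, Finset.sum_const,
      Finset.card_univ, Fintype.card_fin, nsmul_eq_mul, ← Finset.mul_sum]
    rw [← Finset.sum_mul]
    ring
  have e4 : ∑ i, 4 * a i ^ 2 ≤ ∑ i, ∑ j, b i j ^ 2 := by
    refine Finset.sum_le_sum fun i _ => ?_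
    refine le_trans (le_of_eq ?_)
      (Finset.single_le_sum (fun j _ => sq_nonneg (b i j)) (Finset.mem_univ i))
    rw [hbd]
    ring
  have e5 : ∑ i, (f (φ i x) - f x) * (f (φ i x) - f x) = ∑ i, a i ^ 2 :=
    Finset.sum_congr rfl fun i _ => by simp only [ha]; ring
  rw [e1, e2, e3, e5] at h1
  rw [← Finset.mul_sum] at e4
  change _ = ∑ i, a i ^ 2 at h2
  change _ = _ + 2 * ((∑ i, a i) * (∑ i, a i)) at h1
  linarith

theorem isOrderedEigenvalue_two_of_flips (hc : ∀ i z, c (φ i z) = symmDiff (c z) {i})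
    (hadj : ∀ z y, G.Adj z y ↔ ∃ i, y = φ i z)
    (hG : G.Connected) (hD : 1 ≤ D) (hCD : CD G 2 ⊤) :
    IsOrderedEigenvalue G D 2 := by
  classical
  have hdeg := degree_eq_of_flips G hc hadj
  have : Finite V := Finite.of_equiv _ c.symm
  constructor
  · refine (Submodule.rank_mono
      (iSup_eigenspace_Iio_le_span_one G hG (fun x => (hdeg x).le) hCD)).trans ?_
    refine (rank_span_le _).trans ?_
    rw [Cardinal.mk_singleton]
    exact_mod_cast hD
  -- The constant (eigenvalue 0) and the `D` coordinate signs (eigenvalue 2).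
  · let v : Option (Fin D) → V → ℝ := fun o => o.elim (fun _ => 1) fun i x => if i ∈ c x then 1 else -1
    have hflip : ∀ i x, v (some i) (φ i x) = - v (some i) x := by
      intro i x
      simp only [v, Option.elim, hc, Finset.mem_symmDiff, Finset.mem_singleton]
      by_cases h : i ∈ c x <;> simp [h]
    have hstay : ∀ {i j}, j ≠ i → ∀ x, v (some j) (φ i x) = v (some j) x := by
      intro i j hij x
      simp only [v, Option.elim, hc, Finset.mem_symmDiff, Finset.mem_singleton]
      simp [hij]
    have hlin : LinearIndependent ℝ v := by
      rw [Fintype.linearIndependent_iff]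
      intro g hg
      have hx : ∀ x, g none + ∑ i, g (some i) * v (some i) x = 0 := by
        intro x
        have := congrFun hg x
        simpa [Fintype.sum_option, v] using this
      have hi : ∀ i, g (some i) = 0 := by
        intro i
        obtain ⟨x⟩ := hG.nonempty
        have h1 := hx x
        have h2 := hx (φ i x)
        rw [← Finset.add_sum_erase _ _ (Finset.mem_univ i)] at h1 h2
        rw [hflip, Finset.sum_congr rfl fun j hj => by
          rw [hstay (Finset.ne_of_mem_erase hj)]] at h2
        have h3 : g (some i) * v (some i) x = 0 := by linarith
        refine (mul_eq_zero.1 h3).resolve_right ?_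
        simp only [v, Option.elim]
        split_ifs <;> norm_num
      have hn : g none = 0 := by
        obtain ⟨x⟩ := hG.nonempty
        simpa [hi] using hx x
      rintro (_ | i)
      · exact hn
      · exact hi i
    have hmem : ∀ o, v o ∈ ⨆ μ : Set.Iic (2 : ℝ), eigenspace G μ := by
      rintro (_ | i)
      · refine Submodule.mem_iSup_of_mem (⟨0, by simp⟩ : Set.Iic (2 : ℝ)) ⟨memℓp_gen ?_, fun x => ?_⟩
        · exact Summable.of_finite
        · simp [laplacian, v]
      · refine Submodule.mem_iSup_of_mem (⟨2, by simp⟩ : Set.Iic (2 : ℝ)) ⟨memℓp_gen ?_, fun x => ?_⟩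
        · exact Summable.of_finite
        · rw [laplacian, sum_neighborFinset_eq_sum_flip G hc hadj,
            Finset.sum_eq_single_of_mem i (Finset.mem_univ i), hflip]
          · ring
          · intro j _ hj
            rw [hstay hj.symm, sub_self]
    have h := card_le_rank_of_linearIndependent hlin hmem
    rw [Fintype.card_option, Fintype.card_fin] at h
    exact lt_of_lt_of_le (by exact_mod_cast Nat.lt_succ_self D) h

/-- Graph distance is Hamming distance: one flip changes the symmetric difference by one element. -/
theorem ediam_of_flips {V : Type*} {G : SimpleGraph V} {D : ℕ} {c : V ≃ Finset (Fin D)}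
    {φ : Fin D → V → V} (hc : ∀ i z, c (φ i z) = symmDiff (c z) {i})
    (hadj : ∀ z y, G.Adj z y ↔ ∃ i, y = φ i z) : G.ediam = D := by
  have hstep : ∀ i x y, symmDiff (c (φ i x)) (c y) = symmDiff (symmDiff (c x) (c y)) {i} :=
    fun i x y => by rw [hc, symmDiff_right_comm]
  have hle : ∀ n x y, (symmDiff (c x) (c y)).card = n → G.edist x y ≤ n := by
    intro n
    induction n with
    | zero =>
      intro x y h
      rw [Finset.card_eq_zero] at h
      have : x = y := c.injective (symmDiff_eq_bot.1 h)
      simp [this]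
    | succ n ih =>
      intro x y h
      obtain ⟨i, hi⟩ := Finset.card_pos.1 (show 0 < (symmDiff (c x) (c y)).card by lia)
      have e : symmDiff (symmDiff (c x) (c y)) {i} = (symmDiff (c x) (c y)).erase i := by
        ext j
        rw [Finset.mem_symmDiff, Finset.mem_singleton, Finset.mem_erase]
        grind
      have h1 := ih (φ i x) y (by rw [hstep, e, Finset.card_erase_of_mem hi, h]; rfl)
      have h2 : G.edist x (φ i x) = 1 := SimpleGraph.edist_eq_one_iff_adj.2 ((hadj _ _).2 ⟨i, rfl⟩)
      calc G.edist x y ≤ G.edist x (φ i x) + G.edist (φ i x) y := G.edist_triangle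
        _ ≤ 1 + n := by rw [h2]; gcongr
        _ = ((n + 1 : ℕ) : ℕ∞) := by push_cast; ring
  have hge : ∀ {x y} (p : G.Walk x y), (symmDiff (c x) (c y)).card ≤ p.length := by
    intro x y p
    induction p with
    | nil => simp
    | @cons x z y h p ih =>
      obtain ⟨i, rfl⟩ := (hadj _ _).1 h
      rw [hstep] at ih
      rw [SimpleGraph.Walk.length_cons]
      have e : symmDiff (c x) (c y) ⊆ insert i (symmDiff (symmDiff (c x) (c y)) {i}) := by
        intro j hj
        rw [Finset.mem_insert, Finset.mem_symmDiff, Finset.mem_singleton]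
        grind
      exact (Finset.card_le_card e).trans ((Finset.card_insert_le _ _).trans (by lia))
  refine le_antisymm (SimpleGraph.ediam_le_of_edist_le fun x y => ?_) ?_
  · refine (hle _ x y rfl).trans ?_
    exact_mod_cast (Finset.card_le_univ _).trans (by simp)
  · refine le_trans ?_ (SimpleGraph.edist_le_ediam (u := c.symm ∅) (v := c.symm Finset.univ))
    rw [SimpleGraph.edist_eq_sInf]
    refine le_sInf ?_
    rintro _ ⟨p, rfl⟩
    have e : (symmDiff (c (c.symm ∅)) (c (c.symm Finset.univ))).card = D := by
      rw [c.apply_symm_apply, c.apply_symm_apply, ← Finset.bot_eq_empty, bot_symmDiff,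
        Finset.card_univ, Fintype.card_fin]
    exact Nat.cast_le.2 (e.symm.le.trans (hge p))

end Cube
-- Heat flow: from a Lipschitz function to an extremal eigenfunction
section HeatFlow

open Filter Topology

variable {V : Type*} (G : SimpleGraph V) [G.LocallyFinite]

theorem exists_eigenspace_decomposition [Fintype V] (f : V → ℝ) :
    ∃ (g : V → V → ℝ) (lam : V → ℝ), (∀ k, g k ∈ eigenspace G (lam k)) ∧ ∑ k, g k = f := by
  classical
  have hA : (G.lapMatrix ℝ).IsHermitian := by
    rw [Matrix.IsHermitian, Matrix.conjTranspose_eq_transpose_of_trivial]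
    exact SimpleGraph.isSymm_lapMatrix (R := ℝ) G
  have hA' : ∀ h : V → ℝ, ∀ x, -laplacian G h x = (G.lapMatrix ℝ).mulVec h x := by
    intro h x
    rw [SimpleGraph.lapMatrix_mulVec_apply, laplacian, Finset.sum_sub_distrib, Finset.sum_const,
      SimpleGraph.card_neighborFinset_eq_degree, nsmul_eq_mul, neg_sub]
    congr!
  let b := hA.eigenvectorBasis
  refine ⟨fun k => b.repr (WithLp.toLp 2 f) k • (b k : V → ℝ), hA.eigenvalues, fun k => ?_, ?_⟩
  · refine Submodule.smul_mem _ _ ⟨memℓp_gen Summable.of_finite, fun x => ?_⟩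
    rw [hA', hA.mulVec_eigenvectorBasis]
    rfl
  · have := congrArg WithLp.ofLp (b.sum_repr (WithLp.toLp 2 f))
    simpa using this

/-- The maximum principle for subsolutions of the heat equation. -/
theorem le_of_deriv_le_laplacian [Fintype V] {u u' : ℝ → V → ℝ} {C : ℝ}
    (hu : ∀ t x, HasDerivAt (fun s => u s x) (u' t x) t)
    (hle : ∀ t x, u' t x ≤ laplacian G (u t) x) (h0 : ∀ x, u 0 x ≤ C) {T : ℝ} (hT : 0 ≤ T) (x : V) :
    u T x ≤ C := by
  by_contra! hlt
  have hT0 : 0 < T := by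
    rcases hT.eq_or_lt with h | h
    · subst h
      exact absurd (h0 x) (not_le.2 hlt)
    · exact h
  -- Subtracting `δ * t` makes the time derivative strictly negative at a space-time maximum, so
  -- slightly earlier values would be larger.
  obtain ⟨δ, hδ, hδ'⟩ : ∃ δ : ℝ, 0 < δ ∧ C < u T x - δ * T := by
    refine ⟨(u T x - C) / (2 * T), div_pos (sub_pos.2 hlt) (by positivity), ?_⟩
    have : (u T x - C) / (2 * T) * T = (u T x - C) / 2 := by
      field_simp
    linarith
  have hv : ∀ y t, HasDerivAt (fun s => u s y - δ * s) (u' t y - δ) t := fun y t => by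
    simpa using (hu t y).fun_sub ((hasDerivAt_id t).const_mul δ)
  have hmax : ∀ y, ∃ t ∈ Set.Icc 0 T, ∀ s ∈ Set.Icc 0 T, u s y - δ * s ≤ u t y - δ * t := by
    intro y
    have hc : ContinuousOn (fun s => u s y - δ * s) (Set.Icc 0 T) := fun t _ =>
      (hv y t).continuousAt.continuousWithinAt
    obtain ⟨t, ht, h⟩ := isCompact_Icc.exists_isMaxOn ⟨0, Set.left_mem_Icc.2 hT⟩ hc
    exact ⟨t, ht, fun s hs => h hs⟩
  choose τ hτ hτmax using hmax
  have : Nonempty V := ⟨x⟩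
  obtain ⟨m, hm⟩ := Finite.exists_max fun y => u (τ y) y - δ * τ y
  have hall : ∀ y, ∀ s ∈ Set.Icc 0 T, u s y - δ * s ≤ u (τ m) m - δ * τ m := fun y s hs =>
    (hτmax y s hs).trans (hm y)
  have hpos : 0 < τ m := by
    refine lt_of_le_of_ne (hτ m).1 fun h => ?_
    have h1 := hall x T (Set.right_mem_Icc.2 hT)
    rw [← h, mul_zero, sub_zero] at h1
    linarith [h0 m]
  have hneg : u' (τ m) m - δ < 0 := by
    have h1 : laplacian G (u (τ m)) m ≤ 0 := Finset.sum_nonpos fun y _ => by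
      linarith [hall y (τ m) (hτ m)]
    linarith [hle (τ m) m]
  have h1 := (hasDerivAt_iff_tendsto_slope.1 (hv m (τ m))).eventually (gt_mem_nhds hneg)
  have h2 : ∀ᶠ s in 𝓝[<] (τ m), slope (fun s => u s m - δ * s) (τ m) s < 0 :=
    h1.filter_mono (nhdsWithin_mono _ fun s hs => ne_of_lt hs)
  obtain ⟨s, hs, hs'⟩ := (h2.and (Ioo_mem_nhdsLT hpos)).exists
  rw [slope_def_field] at hs
  have h3 := hall m s ⟨hs'.1.le, hs'.2.le.trans (hτ m).2⟩
  exact absurd hs (not_lt.2 (div_nonneg_of_nonpos (by linarith) (by linarith [hs'.2])))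

theorem laplacian_sq_le (f : V → ℝ) (x : V) :
    laplacian G f x ^ 2 ≤ G.degree x * (2 * Gam G f f x) := by
  rw [two_mul_Gam_self, laplacian, ← SimpleGraph.card_neighborFinset_eq_degree]
  exact sq_sum_le_card_mul_sum_sq

theorem abs_laplacian_le {D : ℕ} {f : V → ℝ} {x : V} (hx : G.degree x ≤ D)
    (hf : Gam G f f x ≤ D / 2) : |laplacian G f x| ≤ D := by
  refine abs_le_of_sq_le_sq ?_ (Nat.cast_nonneg D)
  refine (laplacian_sq_le G f x).trans ?_
  have h1 : (G.degree x : ℝ) ≤ D := by exact_mod_cast hx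
  have h2 := Gam_self_nonneg G f x
  nlinarith

/-- The rescaled heat flow of a function with bounded gradient and large oscillation converges to an
eigenfunction with the same properties. -/
theorem exists_mem_eigenspace_of_sub_ge [Fintype V] (hG : G.Connected) {D : ℕ}
    (hD : ∀ x, G.degree x ≤ D) {K : ℝ} (hK : 0 < K) (hCD : CD G K ⊤) {f : V → ℝ} {x₀ y₀ : V}
    (hf : ∀ x, Gam G f f x ≤ D / 2) (hxy : 2 * D / K ≤ f y₀ - f x₀) :
    ∃ φ ∈ eigenspace G K, (∀ x, Gam G φ φ x ≤ D / 2) ∧ 2 * D / K ≤ φ y₀ - φ x₀ := by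
  classical
  obtain ⟨g, lam, hg, rfl⟩ := exists_eigenspace_decomposition G f
  -- Components below `K` would blow up after rescaling. They are constant functions, so dropping
  -- them changes no difference of values, and `w` still solves `∂w = K w + Δw`.
  let c : V → ℝ → ℝ := fun k t => if lam k < K then 0 else Real.exp ((K - lam k) * t)
  let w : ℝ → V → ℝ := fun t x => ∑ k, c k t * g k x
  have hc : ∀ k t, HasDerivAt (c k) ((K - lam k) * c k t) t := by
    intro k t
    by_cases hk : lam k < K
    · simp only [c, hk, if_true, mul_zero]
      exact hasDerivAt_const _ _
    · simp only [c, hk, if_false]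
      have := ((hasDerivAt_id t).const_mul (K - lam k)).exp
      simpa [mul_comm] using this
  have hlap : ∀ t x, laplacian G (w t) x = ∑ k, c k t * (- lam k * g k x) := by
    intro t x
    have e : ∀ k, - lam k * g k x = ∑ y ∈ G.neighborFinset x, (g k y - g k x) := fun k => by
      have := (hg k).2 x
      rw [laplacian] at this
      linarith
    simp only [laplacian, w, e, Finset.mul_sum]
    rw [Finset.sum_comm]
    simp only [← Finset.sum_sub_distrib, mul_sub]
  have hw : ∀ t x, HasDerivAt (fun s => w s x) (K * w t x + laplacian G (w t) x) t := by
    intro t x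
    have h1 : HasDerivAt (fun s => ∑ k, c k s * g k x) (∑ k, (K - lam k) * c k t * g k x) t :=
      HasDerivAt.fun_sum fun k _ => (hc k t).mul_const _
    convert h1 using 1
    rw [hlap, Finset.mul_sum, ← Finset.sum_add_distrib]
    exact Finset.sum_congr rfl fun k _ => by ring
  have hw0 : ∀ x y, w 0 y - w 0 x = (∑ k, g k) y - (∑ k, g k) x := by
    intro x y
    simp only [w, Finset.sum_apply, ← Finset.sum_sub_distrib]
    refine Finset.sum_congr rfl fun k _ => ?_
    by_cases hk : lam k < K
    · rw [eq_of_mem_eigenspace_of_lt G hG hD hCD hk (hg k) x y]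
      ring
    · simp [c, hk]
  -- CD(K,∞) says exactly that `Γ(w,w)` is a subsolution of the heat equation.
  have hΓ : ∀ t, 0 ≤ t → ∀ x, Gam G (w t) (w t) x ≤ D / 2 := by
    intro t ht
    refine le_of_deriv_le_laplacian G (u := fun t => Gam G (w t) (w t))
      (u' := fun t x => 2 * Gam G (w t) (K • w t + laplacian G (w t)) x) ?_ ?_ ?_ ht
    · intro t x
      simp only [Gam_eq G (w _) (w _)]
      have h1 : HasDerivAt (fun s => ∑ y ∈ G.neighborFinset x, (w s y - w s x) * (w s y - w s x))
          (∑ y ∈ G.neighborFinset x, (((K * w t y + laplacian G (w t) y) -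
            (K * w t x + laplacian G (w t) x)) * (w t y - w t x) + (w t y - w t x) *
            ((K * w t y + laplacian G (w t) y) - (K * w t x + laplacian G (w t) x)))) t :=
        HasDerivAt.fun_sum fun y _ => ((hw t y).sub (hw t x)).mul ((hw t y).sub (hw t x))
      refine (h1.div_const 2).congr_deriv ?_
      rw [Gam_eq, ← mul_div_assoc, Finset.mul_sum (G.neighborFinset x) _ (2 : ℝ)]
      refine congrArg (· / 2) (Finset.sum_congr rfl fun y _ => ?_)
      simp only [Pi.add_apply, Pi.smul_apply, smul_eq_mul]
      ring
    · intro t x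
      have h1 := (CD_top_iff G K).1 hCD x (w t)
      rw [Gam2] at h1
      simp only [Gam_add_right, Gam_smul_right, Pi.add_apply, Pi.smul_apply, smul_eq_mul]
      linarith
    · intro x
      refine le_trans (le_of_eq ?_) (hf x)
      simp only [Gam_eq, hw0]
  have hℓ : ∀ t, 0 ≤ t → 2 * D / K ≤ w t y₀ - w t x₀ := by
    intro t ht
    -- The discounted excess oscillation is nondecreasing, because `|Δw| ≤ D` at both endpoints.
    let p : ℝ → ℝ := fun t => Real.exp (-K * t) * (w t y₀ - w t x₀ - 2 * D / K)
    have hp : ∀ t, HasDerivAt p (Real.exp (-K * t) *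
        (laplacian G (w t) y₀ - laplacian G (w t) x₀ + 2 * D)) t := by
      intro t
      have h1 : HasDerivAt (fun s => Real.exp (-K * s)) (Real.exp (-K * t) * (-K)) t := by
        simpa using ((hasDerivAt_id t).const_mul (-K)).exp
      have h2 := h1.fun_mul (((hw t y₀).fun_sub (hw t x₀)).sub_const (2 * D / K))
      refine h2.congr_deriv ?_
      field_simp
      ring
    have hmono : MonotoneOn p (Set.Ici 0) := by
      refine monotoneOn_of_deriv_nonneg (convex_Ici 0)
        (fun t _ => (hp t).continuousAt.continuousWithinAt)
        (fun t _ => (hp t).differentiableAt.differentiableWithinAt) fun t ht => ?_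
      rw [interior_Ici] at ht
      rw [(hp t).deriv]
      have h1 := abs_le.1 (abs_laplacian_le G (hD y₀) (hΓ t (le_of_lt ht) y₀))
      have h2 := abs_le.1 (abs_laplacian_le G (hD x₀) (hΓ t (le_of_lt ht) x₀))
      exact mul_nonneg (Real.exp_pos _).le (by linarith [h1.1, h2.2])
    have h0 : 0 ≤ p 0 := by
      simp only [p, mul_zero, Real.exp_zero, one_mul, hw0]
      linarith
    have h1 := h0.trans (hmono (Set.mem_Ici.2 le_rfl) (Set.mem_Ici.2 ht) ht)
    have h2 := nonneg_of_mul_nonneg_right h1 (Real.exp_pos _)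
    linarith
  let φ : V → ℝ := ∑ k ∈ Finset.univ.filter (fun k => lam k = K), g k
  have hφ : ∀ x, Tendsto (fun t => w t x) atTop (𝓝 (φ x)) := by
    intro x
    have h1 : ∀ k, Tendsto (fun t => c k t * g k x) atTop (𝓝 (if lam k = K then g k x else 0)) := by
      intro k
      rcases lt_trichotomy (lam k) K with hk | hk | hk
      · simp [c, hk, hk.ne]
      · simp [c, hk]
      · simp only [c, not_lt.2 hk.le, hk.ne', if_false]
        rw [← zero_mul (g k x)]
        refine Tendsto.mul_const _ (Real.tendsto_exp_atBot.comp ?_)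
        exact tendsto_id.const_mul_atTop_of_neg (sub_neg.2 hk)
    have h2 := tendsto_finsetSum Finset.univ fun k _ => h1 k
    rw [← Finset.sum_filter] at h2
    simpa [φ, w, Finset.sum_apply] using h2
  refine ⟨φ, ?_, fun x => ?_, ?_⟩
  · refine Submodule.sum_mem _ fun k hk => ?_
    have h1 := hg k
    rwa [(Finset.mem_filter.1 hk).2] at h1
  · refine le_of_tendsto (x := atTop) (f := fun t => Gam G (w t) (w t) x) ?_ ?_
    · simp only [Gam_eq]
      exact (tendsto_finsetSum _ fun y _ =>
        ((hφ y).sub (hφ x)).mul ((hφ y).sub (hφ x))).div_const 2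
    · filter_upwards [eventually_ge_atTop 0] with t ht
      exact hΓ t ht x
  · refine ge_of_tendsto ((hφ y₀).sub (hφ x₀)) ?_
    filter_upwards [eventually_ge_atTop 0] with t ht
    exact hℓ t ht

end HeatFlow
-- Distance spheres in the extremal case
theorem exists_adj_dist_add_one {V : Type*} {G : SimpleGraph V} (hG : G.Connected) {x y : V} {n : ℕ}
    (h : G.dist x y = n + 1) : ∃ z, G.Adj z y ∧ G.dist x z = n := by
  obtain ⟨p, hp⟩ := hG.exists_walk_length_eq_dist y x
  rw [G.dist_comm, h] at hp
  cases p with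
  | nil => simp at hp
  | @cons _ z _ hyz q =>
    rw [SimpleGraph.Walk.length_cons, add_left_inj] at hp
    refine ⟨z, hyz.symm, le_antisymm ?_ ?_⟩
    · rw [G.dist_comm, ← hp]
      exact SimpleGraph.dist_le q
    · have h1 := hG.dist_triangle (u := x) (v := z) (w := y)
      rw [h, SimpleGraph.dist_eq_one_iff_adj.2 hyz.symm] at h1
      lia

theorem dist_le_add_one {V : Type*} {G : SimpleGraph V} (hG : G.Connected) {y z : V} (h : G.Adj y z)
    (x : V) : G.dist x z ≤ G.dist x y + 1 := by
  have h1 := hG.dist_triangle (u := x) (v := y) (w := z)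
  rwa [SimpleGraph.dist_eq_one_iff_adj.2 h] at h1

theorem finite_of_ediam_ne_top {V : Type*} (G : SimpleGraph V) [G.LocallyFinite] (hG : G.Connected)
    (h : G.ediam ≠ ⊤) : Finite V := by
  obtain ⟨x⟩ := hG.nonempty
  have hfin : ∀ n, {y | G.dist x y = n}.Finite := by
    intro n
    induction n with
    | zero =>
      refine (Set.finite_singleton x).subset fun y hy => ?_
      exact (hG.dist_eq_zero_iff.1 hy).symm
    | succ n ih =>
      refine (ih.biUnion fun z _ => (G.neighborFinset z).finite_toSet).subset fun y hy => ?_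
      obtain ⟨z, hz, hz'⟩ := exists_adj_dist_add_one hG hy
      exact Set.mem_biUnion hz' (by simpa using hz)
  rw [← Set.finite_univ_iff]
  refine ((Set.finite_Iic G.diam).biUnion fun n _ => hfin n).subset fun y _ => ?_
  exact Set.mem_biUnion (SimpleGraph.dist_le_diam h (u := x) (v := y)) rfl

section Shells

variable {V : Type*} (G : SimpleGraph V) [G.LocallyFinite]

/-- Equality in Cauchy–Schwarz: the squared deviations of the gradient from 1 sum to `2Γ - 2Δφ +
degree ≤ D - 2D + D`. -/
theorem gradient_eq_one_of_extremal {D : ℕ} (hD : ∀ x, G.degree x ≤ D) {φ : V → ℝ} {x₀ : V}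
    (hφ : Gam G φ φ x₀ ≤ D / 2) (h : (D : ℝ) ≤ laplacian G φ x₀) :
    G.degree x₀ = D ∧ (∀ y, G.Adj x₀ y → φ y = φ x₀ + 1) ∧ Gam G φ φ x₀ = D / 2 := by
  have h1 : ∑ y ∈ G.neighborFinset x₀, (φ y - φ x₀ - 1) ^ 2 =
      2 * Gam G φ φ x₀ - 2 * laplacian G φ x₀ + G.degree x₀ := by
    have e : ∀ y, (φ y - φ x₀ - 1) ^ 2 = (φ y - φ x₀) ^ 2 - 2 * (φ y - φ x₀) + 1 := fun y => by ring
    simp only [e, Finset.sum_add_distrib, Finset.sum_sub_distrib, ← Finset.mul_sum,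
      two_mul_Gam_self, laplacian]
    simp
  have h2 : (G.degree x₀ : ℝ) ≤ D := by exact_mod_cast hD x₀
  have h3 : 0 ≤ ∑ y ∈ G.neighborFinset x₀, (φ y - φ x₀ - 1) ^ 2 :=
    Finset.sum_nonneg fun y _ => sq_nonneg _
  have h4 : ∑ y ∈ G.neighborFinset x₀, (φ y - φ x₀ - 1) ^ 2 = 0 := by linarith
  have h5 : (G.degree x₀ : ℝ) = D := by linarith
  refine ⟨by exact_mod_cast h5, fun y hy => ?_, by linarith⟩
  rw [Finset.sum_eq_zero_iff_of_nonneg fun y _ => sq_nonneg _] at h4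
  have := pow_eq_zero_iff two_ne_zero |>.1 (h4 y (by simpa using hy))
  linarith

/-- Induction on distance, two levels at a time. All common neighbours of `x` and `z` lie on the
middle level, where `φ` is known, so the terms of the relation are equal and must vanish. -/
theorem eq_add_dist_of_gradient_eq_one (hG : G.Connected) {K : ℝ} (hCD : CD G K ⊤) {φ : V → ℝ}
    (hφ : ∀ x, Gam2 G φ φ x = K * Gam G φ φ x) {x₀ : V}
    (h1 : ∀ y, G.Adj x₀ y → φ y = φ x₀ + 1) (z : V) : φ z = φ x₀ + G.dist x₀ z := by
  classical
  have key : ∀ n, ∀ z, G.dist x₀ z = n → φ z = φ x₀ + n := by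
    intro n
    induction n using Nat.strong_induction_on with
    | _ n ih =>
      intro z hz
      match n, ih, hz with
      | 0, ih, hz => simp [hG.dist_eq_zero_iff.1 hz]
      | 1, ih, hz => simpa using h1 z (SimpleGraph.dist_eq_one_iff_adj.1 hz)
      | n + 2, ih, hz =>
        obtain ⟨u, hu, hu'⟩ := exists_adj_dist_add_one hG hz
        obtain ⟨x, hx, hx'⟩ := exists_adj_dist_add_one hG hu'
        have h2 := sum_common_neighbors_eq_zero G hCD (hφ x) (z := z)
          (by rintro rfl; lia) (fun h => by have := dist_le_add_one hG h x₀; lia)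
        rw [Finset.sum_congr rfl (g := fun _ => φ z - (φ x₀ + (n + 2 : ℕ)))] at h2
        · rw [Finset.sum_const, smul_eq_zero] at h2
          rcases h2 with h2 | h2
          · rw [Finset.card_eq_zero] at h2
            have : u ∈ G.neighborFinset x ∩ G.neighborFinset z := by simp [hx, hu.symm]
            rw [h2] at this
            exact absurd this (Finset.notMem_empty u)
          · linarith
        · intro w hw
          simp only [Finset.mem_inter, SimpleGraph.mem_neighborFinset] at hw
          have h3 := dist_le_add_one hG hw.1 x₀
          have h4 := dist_le_add_one hG hw.2.symm x₀
          rw [ih n (by lia) x hx', ih (n + 1) (by lia) w (by lia)]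
          push_cast
          ring
  exact key _ z rfl

/-- The structure of the distance spheres around a vertex of a graph with extremal diameter. -/
structure IsCubicShell (D : ℕ) (f : V → ℕ) (x₀ : V) : Prop where
  degree_eq : ∀ x, G.degree x = D
  eq_zero_iff : ∀ x, f x = 0 ↔ x = x₀
  adj_iff : ∀ x y, G.Adj x y → f y = f x + 1 ∨ f x = f y + 1
  card_down : ∀ x, ((G.neighborFinset x).filter fun y => f y + 1 = f x).card = f x
  sum_common : ∀ [DecidableEq V], ∀ x z, z ≠ x → ¬ G.Adj x z →
    ∑ y ∈ G.neighborFinset x ∩ G.neighborFinset z, ((f z : ℝ) - 2 * f y + f x) = 0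

theorem isCubicShell_of_extremal [Nontrivial V] (hG : G.Connected) {D : ℕ}
    (hD : ∀ x, G.degree x ≤ D) {K : ℝ} (hK : 0 < K) (hCD : CD G K ⊤) {φ : V → ℝ} {x₀ y₀ : V}
    (hφ : φ ∈ eigenspace G K) (hΓ : ∀ x, Gam G φ φ x ≤ D / 2)
    (h : 2 * D / K ≤ φ y₀ - φ x₀) : K = 2 ∧ IsCubicShell G D (G.dist x₀) x₀ := by
  -- By the eigenvalue equation, `Δφ x₀ ≥ 2D + Δφ y₀ ≥ 2D - D`.
  have h0 : (D : ℝ) ≤ laplacian G φ x₀ := by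
    have h1 := hφ.2 x₀
    have h2 := hφ.2 y₀
    have h3 := abs_le.1 (abs_laplacian_le G (hD y₀) (hΓ y₀))
    rw [div_le_iff₀ hK] at h
    linarith [h3.1]
  obtain ⟨h1, h2, h3⟩ := gradient_eq_one_of_extremal G hD (hΓ x₀) h0
  have hnull := Gam_eq_of_mem_eigenspace G hG hD hCD hφ
  have hdist := eq_add_dist_of_gradient_eq_one G hG hCD hnull.1 h2
  have hle : ∀ x y, G.Adj x y → (φ y - φ x) ^ 2 ≤ 1 := by
    intro x y hxy
    have e1 : (G.dist x₀ y : ℝ) ≤ G.dist x₀ x + 1 := by exact_mod_cast dist_le_add_one hG hxy x₀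
    have e2 : (G.dist x₀ x : ℝ) ≤ G.dist x₀ y + 1 := by exact_mod_cast dist_le_add_one hG hxy.symm x₀
    rw [sq_le_one_iff_abs_le_one, abs_le, hdist y, hdist x]
    constructor <;> linarith
  -- The terms are nonnegative and the total is at most 0. Hence every degree is `D` and every edge
  -- changes the level.
  have hsum : ∀ x, ∑ y ∈ G.neighborFinset x, (1 - (φ y - φ x) ^ 2) = (G.degree x : ℝ) - D := by
    intro x
    rw [Finset.sum_sub_distrib, ← two_mul_Gam_self, hnull.2 x x₀, h3]
    simp only [Finset.sum_const, SimpleGraph.card_neighborFinset_eq_degree, nsmul_eq_mul, mul_one]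
    ring
  have hnn : ∀ x, ∀ y ∈ G.neighborFinset x, 0 ≤ 1 - (φ y - φ x) ^ 2 := fun x y hy =>
    sub_nonneg.2 (hle x y (by simpa using hy))
  have hdeg : ∀ x, G.degree x = D := by
    intro x
    refine le_antisymm (hD x) ?_
    have := Finset.sum_nonneg (hnn x)
    rw [hsum, sub_nonneg] at this
    exact_mod_cast this
  have hadj : ∀ x y, G.Adj x y → G.dist x₀ y = G.dist x₀ x + 1 ∨ G.dist x₀ x = G.dist x₀ y + 1 := by
    intro x y hxy
    have e := hsum x
    rw [hdeg, sub_self, Finset.sum_eq_zero_iff_of_nonneg (hnn x)] at e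
    have e1 := e y (by simpa using hxy)
    have e2 : (φ y - φ x - 1) * (φ y - φ x + 1) = 0 := by linarith
    rcases mul_eq_zero.1 e2 with e3 | e3 <;> rw [hdist y, hdist x] at e3
    · left
      have : (G.dist x₀ y : ℝ) = G.dist x₀ x + 1 := by linarith
      exact_mod_cast this
    · right
      have : (G.dist x₀ x : ℝ) = G.dist x₀ y + 1 := by linarith
      exact_mod_cast this
  have hlap0 : laplacian G φ x₀ = D := by
    have := abs_le.1 (abs_laplacian_le G (hD x₀) (hΓ x₀))
    linarith [this.2]
  have hφ0 : K * φ x₀ = - D := by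
    have := hφ.2 x₀
    linarith
  -- The eigenvalue equation reads `D - 2 * down = D - K * dist`. At a neighbour of `x₀` there is
  -- one down-neighbour, whence `K = 2`.
  have hdown : ∀ x, 2 * (((G.neighborFinset x).filter
      fun y => G.dist x₀ y + 1 = G.dist x₀ x).card : ℝ) = K * G.dist x₀ x := by
    intro x
    have e1 := hφ.2 x
    rw [laplacian, Finset.sum_congr rfl
      (g := fun y => 1 - 2 * (if G.dist x₀ y + 1 = G.dist x₀ x then (1 : ℝ) else 0))] at e1
    · rw [Finset.sum_sub_distrib, ← Finset.mul_sum, Finset.sum_boole, Finset.sum_const,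
        SimpleGraph.card_neighborFinset_eq_degree, hdeg, hdist x, nsmul_eq_mul, mul_add, hφ0] at e1
      linarith
    · intro y hy
      rw [hdist y, hdist x]
      rcases hadj x y (by simpa using hy) with e | e
      · rw [if_neg (by lia), e]
        push_cast
        ring
      · rw [if_pos e.symm, e]
        push_cast
        ring
  have hK2 : K = 2 := by
    obtain ⟨y, hy⟩ := hG.preconnected.exists_adj_of_nontrivial x₀
    have e1 := SimpleGraph.dist_eq_one_iff_adj.2 hy
    have e2 := hdown y
    have e3 : ((G.neighborFinset y).filter fun z => G.dist x₀ z + 1 = G.dist x₀ y) = {x₀} := by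
      ext z
      simp only [Finset.mem_filter, SimpleGraph.mem_neighborFinset, Finset.mem_singleton, e1]
      constructor
      · rintro ⟨-, h⟩
        exact (hG.dist_eq_zero_iff.1 (by lia)).symm
      · rintro rfl
        exact ⟨hy.symm, by simp⟩
    rw [e3, e1] at e2
    simp at e2
    linarith
  refine ⟨hK2, hdeg, fun x => ?_, hadj, fun x => ?_, fun x z hzx hxz => ?_⟩
  · rw [hG.dist_eq_zero_iff, eq_comm]
  · have := hdown x
    rw [hK2] at this
    have e : (((G.neighborFinset x).filter
      fun y => G.dist x₀ y + 1 = G.dist x₀ x).card : ℝ) = G.dist x₀ x := by linarith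
    exact_mod_cast e
  · rw [← sum_common_neighbors_eq_zero G hCD (hnull.1 x) hzx hxz]
    refine Finset.sum_congr rfl fun y _ => ?_
    rw [hdist x, hdist y, hdist z]
    ring

namespace IsCubicShell

variable {G} {D : ℕ} {f : V → ℕ} {x₀ : V}

theorem exists_down (h : IsCubicShell G D f x₀) {x : V} (hx : 0 < f x) :
    ∃ y, G.Adj x y ∧ f y + 1 = f x := by
  rw [← h.card_down x] at hx
  obtain ⟨y, hy⟩ := Finset.card_pos.1 hx
  exact ⟨y, by simpa using hy⟩

variable [DecidableEq V]

/-- For `x` and `z` on one level the terms of `sum_common` are ±2 according to whether `y` lies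
below or above. -/
theorem card_common_up (h : IsCubicShell G D f x₀) {x z : V} (hzx : z ≠ x) (hf : f z = f x) :
    ((G.neighborFinset x ∩ G.neighborFinset z).filter fun y => f y = f x + 1).card =
      ((G.neighborFinset x ∩ G.neighborFinset z).filter fun y => f y + 1 = f x).card := by
  have h1 := h.sum_common x z hzx fun hadj => by have := h.adj_iff x z hadj; lia
  rw [Finset.sum_congr rfl (g := fun y => 2 * ((if f y + 1 = f x then (1 : ℝ) else 0) -
    if f y = f x + 1 then (1 : ℝ) else 0))] at h1
  · rw [← Finset.mul_sum, Finset.sum_sub_distrib, Finset.sum_boole, Finset.sum_boole] at h1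
    have h2 := sub_eq_zero.1 ((mul_eq_zero.1 h1).resolve_left two_ne_zero)
    exact_mod_cast h2.symm
  · intro y hy
    simp only [Finset.mem_inter, SimpleGraph.mem_neighborFinset] at hy
    rw [hf]
    rcases h.adj_iff x y hy.1 with e | e
    · rw [if_neg (by lia), if_pos e, e]
      push_cast
      ring
    · rw [if_pos e.symm, if_neg (by lia), e]
      push_cast
      ring

/-- Descent: two common lower neighbours share the two upper neighbours `x` and `z`, hence by
`card_common_up` also two lower ones. -/
theorem card_common_down_le_one (h : IsCubicShell G D f x₀) {x z : V} (hzx : z ≠ x)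
    (hf : f z = f x) :
    ((G.neighborFinset x ∩ G.neighborFinset z).filter fun y => f y + 1 = f x).card ≤ 1 := by
  induction hn : f x generalizing x z with
  | zero => simp
  | succ n ih =>
    rw [← hn]
    by_contra! hlt
    obtain ⟨a, ha, b, hb, hab⟩ := Finset.one_lt_card.1 hlt
    simp only [Finset.mem_filter, Finset.mem_inter, SimpleGraph.mem_neighborFinset] at ha hb
    have h1 := ih (x := a) (z := b) hab.symm (by lia) (by lia)
    rw [show n = f a by lia, ← h.card_common_up hab.symm (by lia)] at h1
    exact hzx (Finset.card_le_one.1 h1 z (by simp [ha.1.2.symm, hb.1.2.symm]; lia) x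
      (by simp [ha.1.1.symm, hb.1.1.symm]; lia))

theorem up_unique (h : IsCubicShell G D f x₀) {x z a b : V} (hzx : z ≠ x)
    (hf : f z = f x) (hxa : G.Adj x a) (hza : G.Adj z a) (ha : f a = f x + 1)
    (hxb : G.Adj x b) (hzb : G.Adj z b) (hb : f b = f x + 1) : a = b :=
  Finset.card_le_one.1 ((h.card_common_up hzx hf).trans_le (h.card_common_down_le_one hzx hf)) a
    (by simp [*]) b (by simp [*])

theorem exists_common_up (h : IsCubicShell G D f x₀) {x z a : V} (hzx : z ≠ x)
    (hf : f z = f x) (hxa : G.Adj x a) (hza : G.Adj z a) (ha : f a + 1 = f x) :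
    ∃ b, G.Adj x b ∧ G.Adj z b ∧ f b = f x + 1 := by
  have h1 : 0 < ((G.neighborFinset x ∩ G.neighborFinset z).filter fun y => f y + 1 = f x).card :=
    Finset.card_pos.2 ⟨a, by simp [*]⟩
  rw [← h.card_common_up hzx hf] at h1
  obtain ⟨b, hb⟩ := Finset.card_pos.1 h1
  simp only [Finset.mem_filter, Finset.mem_inter, SimpleGraph.mem_neighborFinset] at hb
  exact ⟨b, hb.1.1, hb.1.2, hb.2⟩

theorem exists_common_down (h : IsCubicShell G D f x₀) {x z a : V} (hzx : z ≠ x)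
    (hf : f z = f x) (hxa : G.Adj x a) (hza : G.Adj z a) (ha : f a = f x + 1) :
    ∃ b, G.Adj x b ∧ G.Adj z b ∧ f b + 1 = f x := by
  have h1 : 0 < ((G.neighborFinset x ∩ G.neighborFinset z).filter fun y => f y = f x + 1).card :=
    Finset.card_pos.2 ⟨a, by simp [*]⟩
  rw [h.card_common_up hzx hf] at h1
  obtain ⟨b, hb⟩ := Finset.card_pos.1 h1
  simp only [Finset.mem_filter, Finset.mem_inter, SimpleGraph.mem_neighborFinset] at hb
  exact ⟨b, hb.1.1, hb.1.2, hb.2⟩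

theorem card_common_of_eq (h : IsCubicShell G D f x₀) {x z a : V} (hzx : z ≠ x)
    (hf : f z = f x) (hxa : G.Adj x a) (hza : G.Adj z a) :
    (G.neighborFinset x ∩ G.neighborFinset z).card = 2 := by
  have h1 := h.card_common_up hzx hf
  have h2 := h.card_common_down_le_one hzx hf
  have h3 := Finset.card_filter_add_card_filter_not (s := G.neighborFinset x ∩ G.neighborFinset z)
    (fun y => f y = f x + 1)
  rw [Finset.filter_congr (p := fun y => ¬ f y = f x + 1) (q := fun y => f y + 1 = f x)] at h3
  · have h4 : 0 < (G.neighborFinset x ∩ G.neighborFinset z).card :=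
      Finset.card_pos.2 ⟨a, by simp [*]⟩
    lia
  · intro y hy
    simp only [Finset.mem_inter, SimpleGraph.mem_neighborFinset] at hy
    have := h.adj_iff x y hy.1
    lia

/-- Vertices two levels apart that have a common neighbour have exactly two of them. -/
theorem card_common_of_add_two (h : IsCubicShell G D f x₀) (hCD : CD G 2 ⊤) {x z u : V}
    (hf : f z = f x + 2) (hxu : G.Adj x u) (hzu : G.Adj z u) :
    (G.neighborFinset x ∩ G.neighborFinset z).card = 2 := by
  induction hn : f x using Nat.strong_induction_on generalizing x z u with
  | _ n ih =>
    have hfu : f u = f x + 1 := by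
      have h1 := h.adj_iff x u hxu
      have h2 := h.adj_iff z u hzu
      lia
    have hnadj : ∀ y, G.Adj x y → ¬ G.Adj u y := by
      intro y hxy huy
      have h1 := h.adj_iff x y hxy
      have h2 := h.adj_iff u y huy
      lia
    -- This test function is a null vector of `Γ₂ - 2Γ` at `x`. The computation needs `y` and `u` to
    -- have exactly two common neighbours, known when they share a level and by induction when `y`
    -- is two levels below. The relation at `z` then gives -1 for `u` and +1 for every other common
    -- neighbour.
    let k : V → ℝ := fun w => if w ≠ x ∧ (w = u ∨ w ∈ G.neighborFinset u) then 1 else 0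
    have kx : k x = 0 := by simp [k]
    have ku : k u = 1 := by simp [k, hxu.ne']
    have kuw : ∀ w, G.Adj u w → w ≠ x → k w = 1 := fun w h1 h2 => by simp [k, h1, h2]
    have ky : ∀ y, G.Adj x y → y ≠ u → k y = 0 := fun y h1 h2 => by simp [k, hnadj y h1, h2]
    have hu : u ∈ G.neighborFinset x := by simpa using hxu
    have hx : x ∈ G.neighborFinset u := by simpa using hxu.symm
    have hsingle : ∀ F : V → ℝ, (∀ y, G.Adj x y → y ≠ u → F y = 0) →
        ∑ y ∈ G.neighborFinset x, F y = F u := fun F hF =>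
      Finset.sum_eq_single_of_mem u hu fun y h1 h2 => hF y (by simpa using h1) h2
    have hΓ : 2 * Gam G k k x = 1 := by
      rw [two_mul_Gam_self, hsingle]
      · rw [ku, kx]; norm_num
      · intro y h1 h2
        rw [ky y h1 h2, kx]; norm_num
    have hΔ : laplacian G k x = 1 := by
      rw [laplacian, hsingle]
      · rw [ku, kx]; norm_num
      · intro y h1 h2
        rw [ky y h1 h2, kx]; norm_num
    have hcu : ((G.neighborFinset u).card : ℝ) = D := by
      rw [SimpleGraph.card_neighborFinset_eq_degree, h.degree_eq]
    have hcx : ((G.neighborFinset x).card : ℝ) = D := by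
      rw [SimpleGraph.card_neighborFinset_eq_degree, h.degree_eq]
    have hrow_u : ∑ w ∈ G.neighborFinset u, (k w - 2 * k u + k x) * (k w - 2 * k u + k x) =
        D + 3 := by
      rw [← Finset.add_sum_erase _ _ hx, Finset.sum_congr rfl (g := fun _ => (1 : ℝ)),
        Finset.sum_const, Finset.card_erase_of_mem hx, nsmul_eq_mul, kx, ku,
        Nat.cast_pred (Finset.card_pos.2 ⟨x, hx⟩), hcu]
      · ring
      · intro w hw
        simp only [Finset.mem_erase, SimpleGraph.mem_neighborFinset] at hw
        rw [kuw w hw.2 hw.1, ku, kx]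
        norm_num
    have hrow_y : ∀ y, G.Adj x y → y ≠ u →
        ∑ w ∈ G.neighborFinset y, (k w - 2 * k y + k x) * (k w - 2 * k y + k x) = 1 := by
      intro y hxy hyu
      have hcard : (G.neighborFinset y ∩ G.neighborFinset u).card = 2 := by
        rcases h.adj_iff x y hxy with e | e
        · exact h.card_common_of_eq hyu.symm (by lia) hxy.symm hxu.symm
        · exact ih (f y) (by lia) (by lia) hxy.symm hxu.symm rfl
      have hx' : x ∈ G.neighborFinset y ∩ G.neighborFinset u := by simp [hxy.symm, hxu.symm]
      have e : ∀ w ∈ G.neighborFinset y, (k w - 2 * k y + k x) * (k w - 2 * k y + k x) =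
          if w ∈ (G.neighborFinset u).erase x then 1 else 0 := by
        intro w hw
        rw [ky y hxy hyu, kx]
        have hwu : w ≠ u := by
          rintro rfl
          exact hnadj y hxy (by simpa [G.adj_comm] using hw)
        by_cases hwx : w = x
        · simp [hwx, kx]
        · by_cases huw : G.Adj u w
          · simp [huw, hwx, kuw w huw hwx]
          · simp [huw, k, hwu]
      rw [Finset.sum_congr rfl e, ← Finset.sum_filter, Finset.filter_mem_eq_inter,
        Finset.inter_erase, Finset.sum_const, Finset.card_erase_of_mem hx', hcard]
      norm_num
    have hΓ₂ : Gam2 G k k x = 2 * Gam G k k x := by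
      have h1 := four_mul_Gam2 G k k x
      rw [← Finset.add_sum_erase _ _ hu, hrow_u, Finset.sum_congr rfl (g := fun _ => (1 : ℝ)),
        Finset.sum_const, Finset.card_erase_of_mem hu, nsmul_eq_mul,
        Nat.cast_pred (Finset.card_pos.2 ⟨u, hu⟩), hcx, hΔ, hsingle, h.degree_eq, h.degree_eq,
        ku, kx] at h1
      · linarith
      · intro y h1 h2
        rw [ky y h1 h2, kx]
        ring
      · intro y hy
        simp only [Finset.mem_erase, SimpleGraph.mem_neighborFinset] at hy
        exact hrow_y y hy.2 hy.1
    have hzx : z ≠ x := by rintro rfl; lia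
    have h1 := sum_common_neighbors_eq_zero G hCD hΓ₂ hzx fun hadj => by
      have := h.adj_iff x z hadj
      lia
    have hu' : u ∈ G.neighborFinset x ∩ G.neighborFinset z := by simp [hxu, hzu]
    rw [← Finset.add_sum_erase _ _ hu', Finset.sum_congr rfl (g := fun _ => (1 : ℝ)),
      Finset.sum_const, Finset.card_erase_of_mem hu', nsmul_eq_mul,
      Nat.cast_pred (Finset.card_pos.2 ⟨u, hu'⟩), kuw z hzu.symm hzx, ku, kx] at h1
    · have : ((G.neighborFinset x ∩ G.neighborFinset z).card : ℝ) = 2 := by linarith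
      exact_mod_cast this
    · intro y hy
      simp only [Finset.mem_erase, Finset.mem_inter, SimpleGraph.mem_neighborFinset] at hy
      rw [kuw z hzu.symm hzx, ky y hy.2.1 hy.1, kx]
      norm_num

end IsCubicShell

end Shells
-- Half-cubes above the neighbours of `x₀`
section HalfCube

variable {V : Type*} {G : SimpleGraph V} [G.LocallyFinite]

namespace IsCubicShell

variable {D : ℕ} {f : V → ℕ} {x₀ : V}

theorem eq_or_eq_of_common (h : IsCubicShell G D f x₀) (hCD : CD G 2 ⊤) {x z a b c : V}
    (hf : f z = f x + 2) (hxa : G.Adj x a) (hza : G.Adj z a) (hxb : G.Adj x b) (hzb : G.Adj z b)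
    (hxc : G.Adj x c) (hzc : G.Adj z c) (hab : a ≠ b) : c = a ∨ c = b := by
  classical
  by_contra! hc
  have h1 := h.card_common_of_add_two hCD hf hxa hza
  have h2 : ({a, b, c} : Finset V) ⊆ G.neighborFinset x ∩ G.neighborFinset z := by
    intro w hw
    simp only [Finset.mem_insert, Finset.mem_singleton] at hw
    rcases hw with rfl | rfl | rfl <;> simp [*]
  have h3 := Finset.card_le_card h2
  rw [h1, Finset.card_eq_three.2 ⟨a, b, c, hab, hc.1.symm, hc.2.symm, rfl⟩] at h3
  lia

/-- In a cubic shell, the vertices above an atom are matched with the remaining vertices. -/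
theorem existsUnique_adj_of_upperSet (h : IsCubicShell G D f x₀) (hCD : CD G 2 ⊤) {U : V → Prop}
    {x₁ : V} (hx₁ : U x₁) (hU₀ : ¬ U x₀) (hU₁ : ∀ z, U z → f z = 1 → z = x₁) (hx₁f : f x₁ = 1)
    (hadj₀ : ∀ z, f z = 1 → G.Adj x₀ z)
    (hup : ∀ {z v}, G.Adj z v → f v = f z + 1 → U z → U v)
    (hdown : ∀ {z}, U z → 2 ≤ f z → ∃ u, G.Adj z u ∧ f u + 1 = f z ∧ U u) (z : V) :
    (¬ U z → ∃! v, G.Adj z v ∧ U v) ∧ (U z → ∃! v, G.Adj z v ∧ ¬ U v) := by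
  classical
  have hUup : ∀ {z v}, G.Adj z v → ¬ U z → U v → f v = f z + 1 := by
    intro z v hzv hz hv
    rcases h.adj_iff z v hzv with e | e
    · exact e
    · exact absurd (hup hzv.symm e hv) hz
  have hx₀ : f x₀ = 0 := (h.eq_zero_iff x₀).2 rfl
  induction hn : f z using Nat.strong_induction_on generalizing z with
  | _ n ih =>
    have A : ∀ {z a b}, f z < n → ¬ U z → G.Adj z a → U a → G.Adj z b → U b → a = b :=
      fun {z a b} hz hUz h1 h2 h3 h4 => ((ih _ hz z rfl).1 hUz).unique ⟨h1, h2⟩ ⟨h3, h4⟩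
    have A' : ∀ {z}, f z < n → ¬ U z → ∃ v, G.Adj z v ∧ U v :=
      fun {z} hz hUz => ((ih _ hz z rfl).1 hUz).exists
    have B : ∀ {z a b}, f z < n → U z → G.Adj z a → ¬ U a → G.Adj z b → ¬ U b → a = b :=
      fun {z a b} hz hUz h1 h2 h3 h4 => ((ih _ hz z rfl).2 hUz).unique ⟨h1, h2⟩ ⟨h3, h4⟩
    have B' : ∀ {z}, f z < n → U z → ∃ v, G.Adj z v ∧ ¬ U v :=
      fun {z} hz hUz => ((ih _ hz z rfl).2 hUz).exists
    constructor
    · intro hz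
      rcases Nat.eq_zero_or_pos n with h0 | hpos
      · have e : z = x₀ := (h.eq_zero_iff z).1 (by lia)
        subst e
        refine ⟨x₁, ⟨hadj₀ x₁ hx₁f, hx₁⟩, fun v hv => hU₁ v hv.2 ?_⟩
        have := hUup hv.1 hz hv.2
        lia
      · obtain ⟨d, hzd, hd⟩ := h.exists_down (x := z) (by lia)
        have hdU : ¬ U d := fun hU => hz (hup hzd.symm (by lia) hU)
        obtain ⟨q, hdq, hqU⟩ := A' (by lia) hdU
        have hqf := hUup hdq hdU hqU
        have hqz : q ≠ z := by rintro rfl; exact hz hqU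
        -- Existence comes from completing the square on `d`, `z`, `q`. For uniqueness, every
        -- `U`-neighbour of `z` must be adjacent to the partner `q` of `d`, after which `up_unique`
        -- applies.
        have claim : ∀ v, G.Adj z v → U v → G.Adj q v := by
          intro v hzv hvU
          have hvf := hUup hzv hz hvU
          obtain ⟨t, hvt, htf, htU⟩ := hdown hvU (by lia)
          have htz : t ≠ z := by rintro rfl; exact hz htU
          obtain ⟨d₂, hzd₂, htd₂, hd₂⟩ :=
            h.exists_common_down htz (by lia) hzv hvt.symm hvf
          have hd₂U : ¬ U d₂ := fun hU => hz (hup hzd₂.symm (by lia) hU)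
          by_cases hdd : d₂ = d
          · subst hdd
            rw [A (by lia) hd₂U hdq hqU htd₂.symm htU]
            exact hvt.symm
          -- Go down to `e` below `d` and `d₂`. Its partner `s` lies below `t`, and `r` is the other
          -- vertex between `s` and `v`. The vertex `d₃` below `r` and `z` also lies above `e`, so
          -- it is `d` or `d₂`. The first gives `r = q` and the second `r = t`.
          · obtain ⟨e, hde, hd₂e, he⟩ :=
              h.exists_common_down hdd (by lia) hzd.symm hzd₂.symm (by lia)
            have heU : ¬ U e := fun hU => hdU (hup hde.symm (by lia) hU)
            obtain ⟨s, hes, hsU⟩ := A' (by lia) heU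
            have hsf := hUup hes heU hsU
            have lift : ∀ {d' q'}, ¬ U d' → f d' = f d → G.Adj d' e → G.Adj d' q' → U q' →
                G.Adj s q' := by
              intro d' q' hd'U hd'f hd'e hd'q hq'U
              have hne : s ≠ d' := by rintro rfl; exact hd'U hsU
              obtain ⟨b, hd'b, hsb, hb⟩ :=
                h.exists_common_up hne (by lia) hd'e hes.symm (by lia)
              have hbU : U b := hup hsb (by lia) hsU
              rw [A (by lia) hd'U hd'q hq'U hd'b hbU]
              exact hsb
            have hst := lift hd₂U (by lia) hd₂e htd₂.symm htU
            have hcard := h.card_common_of_add_two hCD (x := s) (z := v) (u := t) (by lia) hst hvt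
            obtain ⟨r, hr, hrt⟩ := Finset.exists_mem_ne (by rw [hcard]; lia) t
            simp only [Finset.mem_inter, SimpleGraph.mem_neighborFinset] at hr
            have hrf : f r = n := by
              have h1 := h.adj_iff s r hr.1
              have h2 := h.adj_iff v r hr.2
              lia
            have hrU : U r := hup hr.1 (by lia) hsU
            have hrz : r ≠ z := by rintro rfl; exact hz hrU
            obtain ⟨d₃, hzd₃, hrd₃, hd₃⟩ :=
              h.exists_common_down hrz (by lia) hzv hr.2.symm hvf
            have hd₃U : ¬ U d₃ := fun hU => hz (hup hzd₃.symm (by lia) hU)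
            have hsd₃ : s ≠ d₃ := by rintro rfl; exact hd₃U hsU
            obtain ⟨e₂, hd₃e₂, hse₂, he₂⟩ :=
              h.exists_common_down hsd₃ (by lia) hrd₃.symm hr.1 (by lia)
            have he₂U : ¬ U e₂ := fun hU => hd₃U (hup hd₃e₂.symm (by lia) hU)
            have hee : e₂ = e := B (by lia) hsU hse₂ he₂U hes.symm heU
            subst hee
            rcases h.eq_or_eq_of_common hCD (x := e₂) (z := z) (by lia) hde.symm hzd hd₂e.symm hzd₂
              hd₃e₂.symm hzd₃ (Ne.symm hdd) with e | e
            · subst e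
              rw [A (by lia) hdU hdq hqU hrd₃.symm hrU]
              exact hr.2.symm
            · subst e
              exact absurd (A (by lia) hd₂U hrd₃.symm hrU htd₂.symm htU) hrt
        obtain ⟨v, hzv, hqv, hv⟩ := h.exists_common_up hqz (by lia) hzd hdq.symm hd
        refine ⟨v, ⟨hzv, hup hqv (by lia) hqU⟩, fun v' hv' => ?_⟩
        exact h.up_unique hqz (by lia) hv'.1 (claim v' hv'.1 hv'.2) (hUup hv'.1 hz hv'.2) hzv hqv hv
    · intro hz
      have hwf : ∀ {w}, G.Adj z w → ¬ U w → f w + 1 = f z := fun {w} h1 h2 =>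
        (hUup h1.symm h2 hz).symm
      have hpos : n ≠ 0 := by
        rintro rfl
        exact hU₀ (((h.eq_zero_iff z).1 hn) ▸ hz)
      by_cases h1 : n = 1
      · subst h1
        refine ⟨x₀, ⟨(hadj₀ z hn).symm, hU₀⟩, fun w hw => (h.eq_zero_iff w).1 ?_⟩
        have := hwf hw.1 hw.2
        lia
      · obtain ⟨t, hzt, htf, htU⟩ := hdown hz (by lia)
        obtain ⟨e, hte, heU⟩ := B' (by lia) htU
        have hef := hUup hte.symm heU htU
        have hcard := h.card_common_of_add_two hCD (x := e) (z := z) (u := t) (by lia) hte.symm hzt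
        obtain ⟨s, hs, hst⟩ := Finset.exists_mem_ne (by rw [hcard]; lia) t
        simp only [Finset.mem_inter, SimpleGraph.mem_neighborFinset] at hs
        refine ⟨s, ⟨hs.2, fun hsU => hst (A (by lia) heU hs.1 hsU hte.symm htU)⟩, ?_⟩
        have hsU : ¬ U s := fun hsU => hst (A (by lia) heU hs.1 hsU hte.symm htU)
        rintro s' ⟨hzs', hs'U⟩
        by_contra hne
        have hsf := hwf hs.2 hsU
        have hsf' := hwf hzs' hs'U
        -- A second partner `s'` would make `s`, `s'` and the partner `q` of `d` three common
        -- neighbours of `d` and `z`.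
        obtain ⟨d, hs'd, hsd, hd⟩ :=
          h.exists_common_down (Ne.symm hne) (by lia) hzs'.symm hs.2.symm (by lia)
        have hdU : ¬ U d := fun hU => hsU (hup hsd.symm (by lia) hU)
        obtain ⟨q, hdq, hqU⟩ := A' (by lia) hdU
        have hqf := hUup hdq hdU hqU
        have hqs : q ≠ s := by rintro rfl; exact hsU hqU
        have hqs' : q ≠ s' := by rintro rfl; exact hs'U hqU
        obtain ⟨v, hsv, hqv, hv⟩ := h.exists_common_up hqs (by lia) hsd hdq.symm (by lia)
        have hvU : U v := hup hqv (by lia) hqU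
        have hvz : v = z := A (by lia) hsU hsv hvU hs.2.symm hz
        subst hvz
        rcases h.eq_or_eq_of_common hCD (x := d) (z := v) (by lia) hsd.symm hs.2 hs'd.symm hzs'
          hdq hqv.symm (Ne.symm hne) with e | e
        · exact hqs e
        · exact hqs' e

end IsCubicShell

/-- Exactly one neighbour lies on the other side, so `Δ` is the single jump, which is minus twice
the value. -/
theorem indicator_mem_eigenspace [Finite V] {U : V → Prop} [DecidablePred U]
    (hU : ∀ z, (¬ U z → ∃! v, G.Adj z v ∧ U v) ∧ (U z → ∃! v, G.Adj z v ∧ ¬ U v)) :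
    (fun z => if U z then (1 / 2 : ℝ) else -(1 / 2)) ∈ eigenspace G 2 := by
  refine ⟨memℓp_gen Summable.of_finite, fun z => ?_⟩
  by_cases hz : U z
  · obtain ⟨v, hv, hv'⟩ := (hU z).2 hz
    rw [laplacian, Finset.sum_eq_single_of_mem v (by simpa using hv.1)]
    · simp only [hz, hv.2, if_true, if_false]
      norm_num
    · intro w hw hwv
      have : U w := by
        by_contra hUw
        exact hwv (hv' w ⟨by simpa using hw, hUw⟩)
      simp [this, hz]
  · obtain ⟨v, hv, hv'⟩ := (hU z).1 hz
    rw [laplacian, Finset.sum_eq_single_of_mem v (by simpa using hv.1)]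
    · simp only [hz, hv.2, if_true, if_false]
      norm_num
    · intro w hw hwv
      have : ¬ U w := by
        intro hUw
        exact hwv (hv' w ⟨by simpa using hw, hUw⟩)
      simp [this, hz]

theorem le_rank_eigenspace_of_isCubicShell [Finite V] (hG : G.Connected) {D : ℕ} {x₀ : V}
    (h : IsCubicShell G D (G.dist x₀) x₀) (hCD : CD G 2 ⊤) :
    (D : Cardinal) ≤ Module.rank ℝ (eigenspace G 2) := by
  classical
  let U : V → V → Prop := fun x z => G.dist x z + 1 = G.dist x₀ z
  have hle : ∀ {x}, G.Adj x₀ x → ∀ z, G.dist x₀ z ≤ G.dist x z + 1 := by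
    intro x hx z
    rw [G.dist_comm, G.dist_comm (u := x)]
    exact dist_le_add_one hG hx.symm z
  have hU₁ : ∀ {x z}, U x z → G.dist x₀ z = 1 → z = x := by
    intro x z h1 h2
    simp only [U] at h1
    exact (hG.dist_eq_zero_iff.1 (by lia)).symm
  have hUself : ∀ {x}, G.Adj x₀ x → U x x := fun hx => by
    simp [U, SimpleGraph.dist_eq_one_iff_adj.2 hx]
  have hU₀ : ∀ x, ¬ U x x₀ := fun x => by simp [U]
  have hmem : ∀ x, G.Adj x₀ x →
      (fun z => if U x z then (1 / 2 : ℝ) else -(1 / 2)) ∈ eigenspace G 2 := by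
    intro x hx
    refine indicator_mem_eigenspace (h.existsUnique_adj_of_upperSet hCD (x₁ := x) (hUself hx) (hU₀ x)
      (fun z h1 h2 => hU₁ h1 h2) (SimpleGraph.dist_eq_one_iff_adj.2 hx)
      (fun z hz => SimpleGraph.dist_eq_one_iff_adj.1 hz) ?_ ?_)
    · intro z v hzv hv hz
      simp only [U] at hz ⊢
      have h1 := hle hx v
      have h2 := dist_le_add_one hG hzv x
      lia
    · intro z hz hz2
      simp only [U] at hz ⊢
      obtain ⟨u, hu, hu'⟩ := exists_adj_dist_add_one hG
        (show G.dist x z = (G.dist x z - 1) + 1 by lia)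
      have h1 := hle hx u
      have h2 := dist_le_add_one hG hu x₀
      exact ⟨u, hu.symm, by lia, by lia⟩
  let v : G.neighborSet x₀ → V → ℝ := fun x z => if U x z then (1 / 2 : ℝ) else -(1 / 2)
  -- Subtract the values at `x₀` from those at the neighbour `j`: among the neighbours of `x₀`, the
  -- half-cube of `i` contains only `i`.
  have hlin : LinearIndependent ℝ v := by
    rw [Fintype.linearIndependent_iff]
    intro g hg j
    have h1 := congrFun hg x₀
    have h2 := congrFun hg j
    simp only [Finset.sum_apply, Pi.smul_apply, smul_eq_mul, Pi.zero_apply] at h1 h2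
    have h3 : ∑ i, g i * (v i j - v i x₀) = 0 := by
      simp only [mul_sub, Finset.sum_sub_distrib, h1, h2, sub_self]
    rw [Finset.sum_eq_single_of_mem j (Finset.mem_univ j)] at h3
    · simp only [v, hUself j.2, hU₀, if_true, if_false] at h3
      norm_num at h3
      exact h3
    · intro i _ hij
      have : ¬ U i j := fun hU =>
        hij (Subtype.ext (hU₁ hU (SimpleGraph.dist_eq_one_iff_adj.2 j.2)).symm)
      simp [v, this, hU₀]
  have := card_le_rank_of_linearIndependent hlin fun x => hmem x x.2
  rwa [SimpleGraph.card_neighborSet_eq_degree, h.degree_eq] at this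

end HalfCube

theorem Gam_dist_le {V : Type*} (G : SimpleGraph V) [G.LocallyFinite] (hG : G.Connected) {D : ℕ}
    (hD : ∀ x, G.degree x ≤ D) (x₀ x : V) :
    Gam G (fun y => (G.dist x₀ y : ℝ)) (fun y => (G.dist x₀ y : ℝ)) x ≤ D / 2 := by
  have h1 : ∑ y ∈ G.neighborFinset x, ((G.dist x₀ y : ℝ) - G.dist x₀ x) ^ 2 ≤
      ∑ y ∈ G.neighborFinset x, 1 := by
    refine Finset.sum_le_sum fun y hy => ?_
    have hxy : G.Adj x y := by simpa using hy
    have e1 : (G.dist x₀ y : ℝ) ≤ G.dist x₀ x + 1 := by exact_mod_cast dist_le_add_one hG hxy x₀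
    have e2 : (G.dist x₀ x : ℝ) ≤ G.dist x₀ y + 1 := by exact_mod_cast dist_le_add_one hG hxy.symm x₀
    rw [sq_le_one_iff_abs_le_one, abs_le]
    constructor <;> linarith
  have h2 : (G.degree x : ℝ) ≤ D := by exact_mod_cast hD x
  have h3 := two_mul_Gam_self G (fun y => (G.dist x₀ y : ℝ)) x
  rw [Finset.sum_const, SimpleGraph.card_neighborFinset_eq_degree, nsmul_eq_mul, mul_one] at h1
  linarith

theorem isHypercube_of_diam_eq {V : Type*} [Nontrivial V] (G : SimpleGraph V) [G.LocallyFinite]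
    (hG : G.Connected) {D : ℕ} (hD : ∀ x, G.degree x ≤ D) {K : ℝ} (hK : 0 < K) (hCD : CD G K ⊤)
    (htop : G.ediam ≠ ⊤) (hdiam : (G.diam : ℝ) = 2 * (D : ℝ) / K) : IsHypercube G D := by
  have := finite_of_ediam_ne_top G hG htop
  have := Fintype.ofFinite V
  obtain ⟨x₀, y₀, hxy⟩ := G.exists_dist_eq_diam
  obtain ⟨φ, hφ, hΓ, hφxy⟩ := exists_mem_eigenspace_of_sub_ge G hG hD hK hCD
    (f := fun y => (G.dist x₀ y : ℝ)) (x₀ := x₀) (y₀ := y₀) (Gam_dist_le G hG hD x₀)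
    (by simp [hxy, hdiam])
  obtain ⟨rfl, h⟩ := isCubicShell_of_extremal G hG hD hK hCD hφ hΓ hφxy
  exact isHypercube_of_le_rank G hG hD hK hCD (le_rank_eigenspace_of_isCubicShell hG h hCD)

end GraphCurvature

theorem mainTheorem2 {V : Type*} [Nontrivial V] (G : SimpleGraph V) [G.LocallyFinite]
    (hG : G.Connected) (D : ℕ) (hD : IsGreatest (Set.range fun v : V => G.degree v) D) :
    List.TFAE
      [GraphCurvature.IsHypercube G D,
       ∃ K : ℝ, 0 < K ∧ GraphCurvature.CD G K ⊤ ∧ GraphCurvature.IsOrderedEigenvalue G D K,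
       ∃ K : ℝ, 0 < K ∧ GraphCurvature.CD G K ⊤ ∧
         G.ediam ≠ ⊤ ∧ (G.diam : ℝ) = 2 * (D : ℝ) / K] := by
  have hdeg : ∀ x, G.degree x ≤ D := fun x => hD.2 ⟨x, rfl⟩
  tfae_have 1 → 2 := by
    intro h
    obtain ⟨c, φ, hc, hadj, hcomm, hinv⟩ := h.exists_flips
    have hCD := GraphCurvature.CD_two_of_flips G hc hadj hcomm hinv
    have hD1 : 1 ≤ D := by
      obtain ⟨x⟩ := hG.nonempty
      obtain ⟨y, hy⟩ := hG.preconnected.exists_adj_of_nontrivial x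
      exact ((G.degree_pos_iff_exists_adj x).2 ⟨y, hy⟩).trans_le (hdeg x)
    exact ⟨2, two_pos, hCD,
      GraphCurvature.isOrderedEigenvalue_two_of_flips G hc hadj hG hD1 hCD⟩
  tfae_have 1 → 3 := by
    intro h
    obtain ⟨c, φ, hc, hadj, hcomm, hinv⟩ := h.exists_flips
    have he := GraphCurvature.ediam_of_flips hc hadj
    refine ⟨2, two_pos, GraphCurvature.CD_two_of_flips G hc hadj hcomm hinv, ?_, ?_⟩
    · rw [he]
      exact ENat.natCast_ne_top D
    · rw [SimpleGraph.diam, he, ENat.toNat_natCast]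
      ring
  tfae_have 2 → 1 := by
    rintro ⟨K, hK, hCD, h⟩
    exact GraphCurvature.isHypercube_of_le_rank G hG hdeg hK hCD
      (GraphCurvature.le_rank_eigenspace G hG hdeg hCD h)
  tfae_have 3 → 1 := by
    rintro ⟨K, hK, hCD, htop, hdiam⟩
    exact GraphCurvature.isHypercube_of_diam_eq G hG hdeg hK hCD htop hdiam
  tfae_finish
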